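/- **Definitions.** A *signature* is a finite set of relation symbols $R$, each with a positive arity $k_R$; a *fact* $R(c_1,\dots,c_{k_R})$ is a relation symbol applied to constants from a fixed infinite set, and an *instance* is a finite set of facts. A *functional dependency* (FD) $R:X\to Y$, with $X,Y\subseteq\{1,\dots,k_R\}$, is satisfied by an instance if any two of its $R$-facts that agree on the attributes in $X$ also agree on those in $Y$. A *schema* $\mathbf S=(\mathcal R,\Delta)$ is a signature $\mathcal R$ with a set $\Delta$ of FDs over $\mathcal R$; $\Delta_{|R}$ is the set of the FDs of $\Delta$ that are over $R$. Two sets of FDs are *equivalent* if they are satisfied by the same instances. For an instance $I$ over $\mathbf S$, the *conflict graph* has the facts of $I$ as its nodes and an edge between any two facts that together violate an FD in $\Delta$. A *priority relation* over $I$ is an acyclic binary relation $\succ$ on the facts of $I$ such that $f\succ g$ only if $f$ and $g$ are neighbors in the conflict graph. A subset $J\subseteq I$ is *consistent* if it is an independent set of the conflict graph. For distinct consistent $J,J'\subseteq I$, $J$ is a *global improvement* of $J'$ if for every $f'\in J'\setminus J$ there is $f\in J\setminus J'$ with $f\succ f'$. A *globally-optimal repair* (g-repair) is a consistent $J\subseteq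 I$ that has no global improvement. For a fixed schema $\mathbf S$, the problem *g-categoricity*$\langle\mathbf S\rangle$ is: given an instance $I$ over $\mathbf S$ and a priority relation $\succ$ over $I$, decide whether there is exactly one g-repair. A problem is *coNP-hard* if every language in coNP has a polynomial-time many-one reduction to it. Let $\mathbf S^0$ be the schema with a single relation symbol, of arity $2$, with attributes $A,B$, and with the FDs $A\to B$ and $B\to A$. **Theorem.** The following are equivalent. 1. g-categoricity$\langle\mathbf S^0\rangle$ is coNP-hard. 2. g-categoricity$\langle\mathbf S\rangle$ is coNP-hard for every schema $\mathbf S=(\mathcal R,\Delta)$ for which it is not the case that, for every $R\in\mathcal R$, $\Delta_{|R}$ is equivalent to a single FD over $R$ (which may be trivial). -/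

import Mathlib

namespace CleanDB

/-! ### Signatures, facts and instances -/

/-- The infinite set of constants: all finite bit strings. -/
abbrev Const : Type := List Bool

/-- A relational signature `{R_0, …, R_{num - 1}}`, each symbol having a positive arity. -/
structure Signature where
  num : ℕ
  arity : Fin num → ℕ
  arity_pos : ∀ R, 0 < arity R

/-- A fact `R(t)` over a signature. -/
abbrev Fact (σ : Signature) : Type := Σ R : Fin σ.num, (Fin (σ.arity R) → Const)

/-- A (finite) instance, identified with the set of its facts. -/
abbrev Instance (σ : Signature) : Type := Finset (Fact σ)

/-! ### Functional dependencies and schemas -/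

/-- A functional dependency `rel : lhs → rhs`. -/
structure FD (σ : Signature) where
  rel : Fin σ.num
  lhs : Finset (Fin (σ.arity rel))
  rhs : Finset (Fin (σ.arity rel))

/-- The instance `I` satisfies the functional dependency `d`. -/
def FD.SatisfiedBy {σ : Signature} (d : FD σ) (I : Instance σ) : Prop :=
  ∀ t u : Fin (σ.arity d.rel) → Const, (⟨d.rel, t⟩ : Fact σ) ∈ I → (⟨d.rel, u⟩ : Fact σ) ∈ I →
    (∀ i ∈ d.lhs, t i = u i) → ∀ i ∈ d.rhs, t i = u i

/-- The instance `I` satisfies every functional dependency of `Δ`. -/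
def Satisfies {σ : Signature} (I : Instance σ) (Δ : Set (FD σ)) : Prop :=
  ∀ d ∈ Δ, d.SatisfiedBy I

/-- Equivalence of sets of functional dependencies. -/
def Equivalent {σ : Signature} (Δ Δ' : Set (FD σ)) : Prop :=
  ∀ I : Instance σ, Satisfies I Δ ↔ Satisfies I Δ'

/-- A schema: a signature together with a set of functional dependencies over it. -/
structure Schema where
  sig : Signature
  deps : Set (FD sig)

/-- The dependencies of the schema that are over the relation symbol `R`. -/
def Schema.depsOn (S : Schema) (R : Fin S.sig.num) : Set (FD S.sig) :=
  {d ∈ S.deps | d.rel = R}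

/-- For every relation symbol `R`, the dependencies over `R` are equivalent to a single
functional dependency over `R` (possibly a trivial one). -/
def Schema.SingleFDPerRelation (S : Schema) : Prop :=
  ∀ R : Fin S.sig.num, ∃ d : FD S.sig, d.rel = R ∧ Equivalent (S.depsOn R) {d}

/-- The signature with a single, binary, relation symbol. -/
abbrev sigZero : Signature where
  num := 1
  arity := fun _ => 2
  arity_pos := fun _ => Nat.two_pos

/-- The schema with a single binary relation symbol and the two functional dependencies
`A → B` and `B → A`. -/
abbrev schemaZero : Schema where
  sig := sigZero
  deps := {(⟨(0 : Fin 1), {(0 : Fin 2)}, {(1 : Fin 2)}⟩ : FD sigZero),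
    (⟨(0 : Fin 1), {(1 : Fin 2)}, {(0 : Fin 2)}⟩ : FD sigZero)}

/-! ### Conflict hypergraphs, priorities and globally-optimal repairs -/

section Repairs

variable {σ : Signature}

/-- The conflict graph of the instance `I` over the schema `S`: its edges are the sets of two
facts of `I` that violate some functional dependency of `S`. (A set `{f, f}` violates none.) -/
def conflictGraph (S : Schema) (I : Instance S.sig) : Set (Finset (Fact S.sig)) :=
  {e | ∃ f ∈ I, ∃ g ∈ I, e = {f, g} ∧ ∃ d ∈ S.deps, ¬ d.SatisfiedBy {f, g}}

/-- Two facts are neighbors in a hypergraph if they co-occur in some hyperedge. -/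
def Neighbors (H : Set (Finset (Fact σ))) (f g : Fact σ) : Prop :=
  ∃ e ∈ H, f ∈ e ∧ g ∈ e

/-- `(I, H, prec)` is an inconsistent prioritizing instance, where `prec f g` reads `f ≻ g`. -/
structure IsPrioritizing (I : Instance σ) (H : Set (Finset (Fact σ)))
    (prec : Fact σ → Fact σ → Prop) : Prop where
  edge_subset : ∀ e ∈ H, e ⊆ I
  mem : ∀ f g, prec f g → f ∈ I ∧ g ∈ I
  acyclic : ∀ f, ¬ Relation.TransGen prec f f
  neighbors : ∀ f g, prec f g → Neighbors H f g

/-- `J` is a consistent subinstance of `I`: it contains no hyperedge. -/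
def IsConsistentSub (I : Instance σ) (H : Set (Finset (Fact σ))) (J : Instance σ) : Prop :=
  J ⊆ I ∧ ∀ e ∈ H, ¬ e ⊆ J

/-- `J` is a global improvement of `J'`. -/
def IsGlobalImprovement (I : Instance σ) (H : Set (Finset (Fact σ)))
    (prec : Fact σ → Fact σ → Prop) (J J' : Instance σ) : Prop :=
  IsConsistentSub I H J ∧ IsConsistentSub I H J' ∧ J ≠ J' ∧
    ∀ f' ∈ J' \ J, ∃ f ∈ J \ J', prec f f'

/-- `J` is a globally-optimal repair. -/
def IsGRepair (I : Instance σ) (H : Set (Finset (Fact σ)))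
    (prec : Fact σ → Fact σ → Prop) (J : Instance σ) : Prop :=
  IsConsistentSub I H J ∧ ¬ ∃ K, IsGlobalImprovement I H prec K J

end Repairs

/-! ### The problem g-categoricity for a fixed schema -/

/-- An input of g-categoricity over the schema `S`: an instance, given by a list of its facts, and
a priority relation over it, given by a list of pairs. The pair `(f, g)` is listed if `f ≻ g`. The
conflict hypergraph is the conflict graph of the instance over `S`. -/
structure Input (S : Schema) where
  facts : List (Fact S.sig)
  pairs : List (Fact S.sig × Fact S.sig)
  valid : IsPrioritizing facts.toFinset (conflictGraph S facts.toFinset)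
    (fun f g => (f, g) ∈ pairs)

/-- `J` is a globally-optimal repair of the input. -/
def Input.IsGRepair {S : Schema} (D : Input S) (J : Instance S.sig) : Prop :=
  CleanDB.IsGRepair D.facts.toFinset (conflictGraph S D.facts.toFinset)
    (fun f g => (f, g) ∈ D.pairs) J

/-- g-categoricity over `S`, as the set of its yes-instances: there is exactly one
globally-optimal repair. -/
def GCategoricity (S : Schema) : Set (Input S) :=
  {D | ∃! J : Instance S.sig, D.IsGRepair J}

/-- The alphabet in which inputs of g-categoricity are written. -/
inductive Token where
  | bit (b : Bool)
  | rel
  | endConst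
  | endFact
  | endInstance
  deriving DecidableEq, Fintype

/-- A constant is written as its bits, followed by an end marker. -/
def encodeConst (c : Const) : List Token :=
  c.map Token.bit ++ [Token.endConst]

/-- A fact is written as the index of its relation symbol in unary, followed by its constants and
an end marker. -/
def encodeFact {σ : Signature} (f : Fact σ) : List Token :=
  List.replicate (f.1 : ℕ) Token.rel ++ (List.ofFn f.2).flatMap encodeConst ++ [Token.endFact]

/-- An input is written as the list of its facts, an end marker, and the list of the facts
`f₁, g₁, f₂, g₂, …` of its priority pairs. -/
def encodeInput {S : Schema} (D : Input S) : List Token :=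
  D.facts.flatMap encodeFact ++ [Token.endInstance] ++
    D.pairs.flatMap (fun p => encodeFact p.1 ++ encodeFact p.2)

/-! ### coNP-hardness -/

/-- Bit strings. -/
abbrev Str : Type := List Bool

/-- A pair of bit strings is written with a separator between its components. -/
def encodePair (p : Str × Str) : List (Option Bool) :=
  p.1.map some ++ none :: p.2.map some

/-- `f` is computable in polynomial time by a (multi-stack) Turing machine, with respect to the
given encodings of the arguments and of the values. -/
def PolyTime {α β Γ₀ Γ₁ : Type} (ea : α → List Γ₀) (eb : β → List Γ₁) (f : α → β) : Prop :=
  Nonempty (Turing.TM2ComputableInPolyTime ea eb f)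

/-- `L` is in NP: membership has certificates of polynomial length that a polynomial-time
verifier can check. -/
def InNP (L : Set Str) : Prop :=
  ∃ (V : Str × Str → Bool) (p : Polynomial ℕ),
    PolyTime encodePair Computability.encodeBool V ∧
    ∀ x, x ∈ L ↔ ∃ w : Str, w.length ≤ p.eval x.length ∧ V (x, w) = true

/-- `L` is in coNP: its complement is in NP. -/
def InCoNP (L : Set Str) : Prop := InNP Lᶜ

/-- The decision problem with yes-instances `P`, and with inputs written by means of `enc`, is
coNP-hard: every language in coNP has a polynomial-time many-one reduction to it. -/
def CoNPHard {α Γ : Type} (enc : α → List Γ) (P : Set α) : Prop :=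
  ∀ L : Set Str, InCoNP L →
    ∃ f : Str → α, PolyTime (id : Str → List Bool) enc f ∧ ∀ x, x ∈ L ↔ f x ∈ P

/-- The problem g-categoricity over the schema `S` is coNP-hard. -/
def GCategoricityCoNPHard (S : Schema) : Prop :=
  CoNPHard (encodeInput (S := S)) (GCategoricity S)

end CleanDB

/-! The implication from 2 to 1 only needs that the two key constraints of S⁰ do not reduce to one
FD (`not_singleFDPerRelation_schemaZero`). For the converse, every other schema receives a
polynomial-time reduction from g-categoricity over S⁰.

Whether two facts over R conflict depends only on the set of attributes on which they agree
(`conflict_iff`); call this set violating if they do. The non-violating sets are the sets closed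
under the FDs, so they are stable under intersection. If the violating sets are also stable under
intersection, there is a least one X₀; with Y₀ the closure of X₀, the FD X₀ → Y₀ is equivalent to
all of them unless some violating X₁ contains Y₀. So failure of the single-FD condition leaves two
cases (`exists_of_not_single`).

Grid: P and Q are violating but P ∩ Q is not. Spreading the two constants of a binary fact over the
attributes makes facts agree on P, on Q or on P ∩ Q according to which constants coincide. The
conflict graph of S⁰ is copied exactly, and so are its repairs (`gCategoricityCoNPHard_of_grid`).

Chain: X₀ ⊂ Y₀ ⊂ X₁. Here one can build facts sorted into blocks and, inside a block, into groups,
such that facts conflict exactly if their blocks differ, or their groups agree and they are distinct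
(`conflict_node_iff`). On such a graph S⁰ is simulated by a game with three blocks. A set in block 0
describes a pair of candidate repairs of the given instance; a set in block 1 is an attempt to
refute the pair; the single node of block 2 is preferred to all of block 1. The top node is always
an optimal repair, and it is the only one if and only if each nonempty consistent set in block 0 is
dominated node by node by a consistent set in block 1 (`existsUnique_iff`). A refutation names a
mode: candidate c has an improvement, candidate c is not consistently described, or the first
candidate is contained in the second. Unrefuted sets therefore exist exactly if there are two
optimal repairs, the first not inside the second (`exists_not_refuted`,
`exists_optimal_not_subset`). Optimal repairs exist and distinct ones are incomparable, so this says
that the given instance has more than one.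

Both reductions replace each fact and each priority by a fixed list of facts with constants filled
in. That this takes polynomial time is `PolyTime.template`. It rests on `PolyTime.postProc`, which
appends to an arbitrary polynomial-time machine a second phase that rewrites its output block by
block. -/

namespace CleanDB

open Turing Function

/-! ### Post-processing the output of a Turing machine -/

/-- The number of `push` operations in a statement. -/
def pushCount {K : Type} {Γ : K → Type} {Λ σ : Type} : TM2.Stmt Γ Λ σ → ℕ
  | .push _ _ q => pushCount q + 1
  | .peek _ _ q => pushCount q
  | .pop _ _ q => pushCount q
  | .load _ q => pushCount q
  | .branch _ q₁ q₂ => pushCount q₁ + pushCount q₂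
  | .goto _ => 0
  | .halt => 0

/-- One step runs one statement, along a single path of its branches, so adding the pushes of both
branches overestimates the growth. -/
theorem length_stepAux_le {K : Type} [DecidableEq K] {Γ : K → Type} {Λ σ : Type}
    (s : TM2.Stmt Γ Λ σ) (v : σ) (S : ∀ k, List (Γ k)) (k : K) :
    ((TM2.stepAux s v S).stk k).length ≤ (S k).length + pushCount s := by
  induction s generalizing v S with
  | push k' f q ih =>
    refine (ih _ _).trans ?_
    by_cases h : k = k'
    · subst h; simp [pushCount]; omega
    · simp [update_of_ne h, pushCount]
  | peek k' f q ih => exact ih _ _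
  | pop k' f q ih =>
    refine (ih _ _).trans ?_
    by_cases h : k = k'
    · subst h; simp [pushCount]
    · simp [update_of_ne h, pushCount]
  | load f q ih => exact ih _ _
  | branch f q₁ q₂ ih₁ ih₂ =>
    simp only [TM2.stepAux, pushCount]
    cases f v
    · exact (ih₂ v S).trans (by omega)
    · exact (ih₁ v S).trans (by omega)
  | goto f => simp [pushCount]
  | halt => simp [pushCount]

theorem iterate_bind_none {α : Type*} (f : α → Option α) (n : ℕ) :
    (flip bind f)^[n] none = none := by
  induction n with
  | zero => rfl
  | succ n ih => rw [iterate_succ_apply]; exact ih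

/-- The running time of the second phase depends on the length of the first phase's output. This
bounds that length by a linear function of the running time. -/
theorem length_iterate_step_le (tm : FinTM2) (B : ℕ) (hB : ∀ l, pushCount (tm.m l) ≤ B)
    (k : tm.K) (n : ℕ) (c c' : tm.Cfg) (h : (flip bind tm.step)^[n] (some c) = some c') :
    (c'.stk k).length ≤ (c.stk k).length + B * n := by
  induction n generalizing c with
  | zero => cases h; simp
  | succ n ih =>
    rw [iterate_succ_apply] at h
    change (flip bind tm.step)^[n] (tm.step c) = _ at h
    obtain ⟨l, v, S⟩ := c
    cases l with
    | none =>
      rw [show tm.step ⟨none, v, S⟩ = none from rfl, iterate_bind_none] at h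
      cases h
    | some l =>
      refine (ih _ h).trans ?_
      have := length_stepAux_le (tm.m l) v S k
      have := hB l
      change ((TM2.stepAux (tm.m l) v S).stk k).length + B * n ≤ (S k).length + B * (n + 1)
      rw [Nat.mul_succ]
      omega

/-- A string transformation: a finite automaton annotates every letter of the input with its
state; the annotated string is cut into blocks in front of the letters accepted by `isStart`; each
block is then replaced by the concatenation of its images under the homomorphisms `passes`. -/
structure PostProc (Q Γ₁ Γ₂ : Type) where
  init : Q
  next : Q → Γ₁ → Q
  isStart : Q × Γ₁ → Bool
  passes : List (Q × Γ₁ → List Γ₂)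

namespace PostProc

variable {Q Γ₁ Γ₂ : Type}

/-- The input annotated with the states of the automaton, started in state `q`. -/
def annotate (P : PostProc Q Γ₁ Γ₂) : Q → List Γ₁ → List (Q × Γ₁)
  | _, [] => []
  | q, γ :: w => (q, γ) :: P.annotate (P.next q γ) w

theorem length_annotate (P : PostProc Q Γ₁ Γ₂) (q : Q) (w : List Γ₁) :
    (P.annotate q w).length = w.length := by
  induction w generalizing q with
  | nil => rfl
  | cons γ w ih => simp [annotate, ih]

/-- The image of a block under the first `j` passes. -/
def image (P : PostProc Q Γ₁ Γ₂) (j : ℕ) (b : List (Q × Γ₁)) : List Γ₂ :=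
  (P.passes.take j).flatMap fun h => b.flatMap h

/-- A block starts with a letter accepted by `isStart`, and has no other such letter. -/
def IsBlock (P : PostProc Q Γ₁ Γ₂) (b : List (Q × Γ₁)) : Prop :=
  ∃ c l, b = c :: l ∧ P.isStart c = true ∧ ∀ x ∈ l, P.isStart x = false

/-- The stacks used for post-processing. -/
inductive Stack
  | todo
  | block
  | aux
  | out
  deriving DecidableEq

instance : Fintype Stack :=
  ⟨{.todo, .block, .aux, .out}, fun x => by cases x <;> decide⟩

/-- The labels used for post-processing. -/
inductive Label (Q Γ₁ : Type) (m : ℕ)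
  | read (q : Q)
  | keep (q : Q) (γ : Γ₁)
  | collect
  | stash (x : Q × Γ₁)
  | down (j : Fin (m + 1))
  | downPush (j : Fin (m + 1)) (x : Q × Γ₁)
  | up (j : Fin (m + 1))
  | upPush (j : Fin (m + 1)) (x : Q × Γ₁)
  | finish
  deriving Fintype

/-! ### The machine with an appended post-processing phase -/

section Machine

variable (P : PostProc Q Γ₁ Γ₂) (tm : FinTM2) (e : tm.Γ tm.k₁ ≃ Γ₁)

/-- The labels of the post-processing phase for `P`. -/
abbrev Lab : Type := Label Q Γ₁ P.passes.length

/-- The stack alphabets of the extended machine. -/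
abbrev Alph (Q Γ₁ Γ₂ : Type) (tm : FinTM2) : tm.K ⊕ Stack → Type
  | .inl k => tm.Γ k
  | .inr .todo => Q × Γ₁
  | .inr .block => Q × Γ₁
  | .inr .aux => Q × Γ₁
  | .inr .out => Γ₂

/-- The statements of the extended machine. -/
abbrev St : Type := TM2.Stmt (Alph Q Γ₁ Γ₂ tm) (tm.Λ ⊕ P.Lab) (tm.σ × P.Lab)

/-- A statement of the original machine, as one of the extended machine. -/
def liftStmt : TM2.Stmt tm.Γ tm.Λ tm.σ → P.St tm
  | .push k f q => .push (.inl k) (fun v => f v.1) (liftStmt q)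
  | .peek k f q => .peek (.inl k) (fun v o => (f v.1 o, v.2)) (liftStmt q)
  | .pop k f q => .pop (.inl k) (fun v o => (f v.1 o, v.2)) (liftStmt q)
  | .load f q => .load (fun v => (f v.1, v.2)) (liftStmt q)
  | .branch f q₁ q₂ => .branch (fun v => f v.1) (liftStmt q₁) (liftStmt q₂)
  | .goto f => .goto fun v => .inl (f v.1)
  | .halt => .goto fun _ => .inr (.read P.init)

/-- Pop from stack `k`, and jump to a label that depends on the letter. -/
def popGoto (k : tm.K ⊕ Stack) (F : Option (Alph Q Γ₁ Γ₂ tm k) → P.Lab) : P.St tm :=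
  .pop k (fun v o => (v.1, F o)) (.goto fun v => .inr v.2)

/-- Push the letters of a word onto the output stack. -/
def pushOut (s : P.St tm) : List Γ₂ → P.St tm
  | [] => s
  | x :: w => .push (.inr .out) (fun _ => x) (pushOut s w)

/-- The pass with index `j - 1`. -/
def pass (j : ℕ) (x : Q × Γ₁) : List Γ₂ :=
  (P.passes[j - 1]?).elim [] (· x)

/-- The program of the post-processing phase. -/
def prog : P.Lab → P.St tm
  | .read q => P.popGoto tm (.inl tm.k₁) fun o => o.elim .collect fun γ => .keep q (e γ)
  | .keep q γ => .push (.inr .todo) (fun _ => (q, γ)) (.goto fun _ => .inr (.read (P.next q γ)))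
  | .collect => P.popGoto tm (.inr .todo) fun o => o.elim .finish .stash
  | .stash x => .push (.inr .block) (fun _ => x) (.goto fun _ =>
      .inr (if P.isStart x then .down (Fin.last _) else .collect))
  | .down j => P.popGoto tm (.inr .block) fun o => o.elim (.up j) (.downPush j)
  | .downPush j x => .push (.inr .aux) (fun _ => x) (.goto fun _ => .inr (.down j))
  | .up j => P.popGoto tm (.inr .aux) fun o =>
      o.elim (if j = 0 then .collect else .down ⟨j - 1, by omega⟩) (.upPush j)
  | .upPush j x =>
      if j = 0 then .goto fun _ => .inr (.up j)
      else .push (.inr .block) (fun _ => x)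
        (P.pushOut tm (.goto fun _ => .inr (.up j)) (P.pass j x).reverse)
  | .finish => .load (fun _ => (tm.initialState, .read P.init)) .halt

/-- The machine that runs `tm` and then post-processes its output. -/
def machine [Fintype Q] [Fintype Γ₁] : FinTM2 :=
  letI := tm.kDecidableEq
  letI := tm.kFin
  letI := tm.ΛFin
  letI := tm.σFin
  { K := tm.K ⊕ Stack
    k₀ := .inl tm.k₀
    k₁ := .inr .out
    Γ := Alph Q Γ₁ Γ₂ tm
    Λ := tm.Λ ⊕ P.Lab
    main := .inl tm.main
    σ := tm.σ × P.Lab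
    initialState := (tm.initialState, .read P.init)
    Γk₀Fin := tm.Γk₀Fin
    m := fun l => match l with
      | .inl l => P.liftStmt tm (tm.m l)
      | .inr l => P.prog tm e l }

/-- The stacks of the extended machine. -/
def stks (S : ∀ k, List (tm.Γ k)) (A C D : List (Q × Γ₁)) (O : List Γ₂) :
    ∀ k, List (Alph Q Γ₁ Γ₂ tm k)
  | .inl k => S k
  | .inr .todo => A
  | .inr .block => C
  | .inr .aux => D
  | .inr .out => O

section Updates

variable {tm} (S : ∀ k, List (tm.Γ k)) (A C D X : List (Q × Γ₁)) (O Y : List Γ₂)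

@[simp] theorem update_inl (k : tm.K) (x : List (tm.Γ k)) :
    update (stks tm S A C D O) (.inl k) x = stks tm (update S k x) A C D O := by
  funext i
  rcases i with i | i
  · by_cases h : i = k
    · subst h; simp [stks]
    · rw [update_of_ne (by simpa using h)]; simp [stks, update_of_ne h]
  · rw [update_of_ne (by simp)]; cases i <;> rfl

@[simp] theorem update_todo :
    update (stks tm S A C D O) (.inr .todo) X = stks tm S X C D O := by
  funext i
  rcases i with i | i
  · rw [update_of_ne (by simp)]; rfl
  · cases i <;> first | (rw [update_self]; rfl) | (rw [update_of_ne (by simp)]; rfl)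

@[simp] theorem update_block :
    update (stks tm S A C D O) (.inr .block) X = stks tm S A X D O := by
  funext i
  rcases i with i | i
  · rw [update_of_ne (by simp)]; rfl
  · cases i <;> first | (rw [update_self]; rfl) | (rw [update_of_ne (by simp)]; rfl)

@[simp] theorem update_aux :
    update (stks tm S A C D O) (.inr .aux) X = stks tm S A C X O := by
  funext i
  rcases i with i | i
  · rw [update_of_ne (by simp)]; rfl
  · cases i <;> first | (rw [update_self]; rfl) | (rw [update_of_ne (by simp)]; rfl)

@[simp] theorem update_out :
    update (stks tm S A C D O) (.inr .out) Y = stks tm S A C D Y := by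
  funext i
  rcases i with i | i
  · rw [update_of_ne (by simp)]; rfl
  · cases i <;> first | (rw [update_self]; rfl) | (rw [update_of_ne (by simp)]; rfl)

end Updates

/-- A configuration of `tm`, as one of the extended machine. -/
def liftCfg (p : P.Lab) (c : tm.Cfg) :
    TM2.Cfg (Alph Q Γ₁ Γ₂ tm) (tm.Λ ⊕ P.Lab) (tm.σ × P.Lab) :=
  ⟨some (c.l.elim (.inr (.read P.init)) .inl), (c.var, p), stks tm c.stk [] [] [] []⟩

/-- Simulation of the original machine: its stacks evolve unchanged, the new ones stay empty, and
halting becomes a jump to the first label of the second phase. -/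
theorem stepAux_liftStmt (p : P.Lab) (s : TM2.Stmt tm.Γ tm.Λ tm.σ) (v : tm.σ)
    (S : ∀ k, List (tm.Γ k)) :
    TM2.stepAux (P.liftStmt tm s) (v, p) (stks tm S [] [] [] []) =
      P.liftCfg tm p (TM2.stepAux s v S) := by
  induction s generalizing v S with
  | push k f q ih => simp only [liftStmt, TM2.stepAux, update_inl]; exact ih _ _
  | peek k f q ih => exact ih _ _
  | pop k f q ih => simp only [liftStmt, TM2.stepAux, update_inl]; exact ih _ _
  | load f q ih => exact ih _ _
  | branch f q₁ q₂ ih₁ ih₂ =>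
    simp only [liftStmt, TM2.stepAux]
    cases f v
    · exact ih₂ _ _
    · exact ih₁ _ _
  | goto f => rfl
  | halt => rfl

variable [Fintype Q] [Fintype Γ₁]

theorem iterate_liftCfg (p : P.Lab) (n : ℕ) (c c' : tm.Cfg)
    (h : (flip bind tm.step)^[n] (some c) = some c') :
    (flip bind (P.machine tm e).step)^[n] (some (P.liftCfg tm p c)) =
      some (P.liftCfg tm p c') := by
  induction n generalizing c with
  | zero => cases h; rfl
  | succ n ih =>
    rw [iterate_succ_apply] at h ⊢
    change (flip bind tm.step)^[n] (tm.step c) = _ at h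
    obtain ⟨l, v, S⟩ := c
    cases l with
    | none =>
      rw [show tm.step ⟨none, v, S⟩ = none from rfl, iterate_bind_none] at h
      cases h
    | some l =>
      rw [← ih _ h]
      congr 1
      exact congrArg some (P.stepAux_liftStmt tm p (tm.m l) v S)

/-- A configuration of the post-processing phase. -/
def cfg (l p : P.Lab) (S : ∀ k, List (tm.Γ k)) (A C D : List (Q × Γ₁)) (O : List Γ₂) :
    (P.machine tm e).Cfg :=
  (⟨some (.inr l), (tm.initialState, p), stks tm S A C D O⟩ :
    TM2.Cfg (Alph Q Γ₁ Γ₂ tm) (tm.Λ ⊕ P.Lab) (tm.σ × P.Lab))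

/-- From the first configuration, the machine reaches the second within `n` steps. -/
def Run (n : ℕ) (l : P.Lab) (S : ∀ k, List (tm.Γ k)) (A C D : List (Q × Γ₁)) (O : List Γ₂)
    (l' : P.Lab) (S' : ∀ k, List (tm.Γ k)) (A' C' D' : List (Q × Γ₁)) (O' : List Γ₂) : Prop :=
  ∀ p, ∃ p', Nonempty (StateTransition.EvalsToInTime (P.machine tm e).step
    (P.cfg tm e l p S A C D O) (some (P.cfg tm e l' p' S' A' C' D' O')) n)

end Machine

end PostProc

end CleanDB

/-! ### Correctness and step counts of the post-processing phase -/

namespace CleanDB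

open Turing Function

namespace PostProc

variable {Q Γ₁ Γ₂ : Type} {P : PostProc Q Γ₁ Γ₂} {tm : FinTM2} {e : tm.Γ tm.k₁ ≃ Γ₁}

theorem stepAux_pushOut (s : P.St tm) (w : List Γ₂) (v : tm.σ × P.Lab)
    (S : ∀ k, List (tm.Γ k)) (A C D : List (Q × Γ₁)) (O : List Γ₂) :
    TM2.stepAux (P.pushOut tm s w) v (stks tm S A C D O) =
      TM2.stepAux s v (stks tm S A C D (w.reverse ++ O)) := by
  induction w generalizing O with
  | nil => rfl
  | cons x w ih =>
    simp only [pushOut, TM2.stepAux, update_out]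
    rw [ih]
    simp [stks]

theorem stk_haltList_self (tm : FinTM2) (w : List (tm.Γ tm.k₁)) :
    (haltList tm w).stk tm.k₁ = w := by
  simp [haltList]

/-- A halted machine has all stacks empty except the output stack, so throughout the reading loop
the old stacks are again those of a halted configuration, with a shorter output. -/
theorem update_haltList (tm : FinTM2) (w w' : List (tm.Γ tm.k₁)) :
    update (haltList tm w).stk tm.k₁ w' = (haltList tm w').stk := by
  funext k
  by_cases h : k = tm.k₁
  · subst h; simp [stk_haltList_self]
  · simp [haltList, h]

theorem image_succ (j : ℕ) (b : List (Q × Γ₁)) (hj : j < P.passes.length) :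
    P.image (j + 1) b = P.image j b ++ b.flatMap (P.pass (j + 1)) := by
  have : P.pass (j + 1) = P.passes[j] := by
    funext x
    simp [pass, List.getElem?_eq_getElem hj]
  rw [image, List.take_add_one, List.getElem?_eq_getElem hj, this, List.flatMap_append]
  simp [image]

variable [Fintype Q] [Fintype Γ₁]

theorem Run.mono {n n' : ℕ} {l l' : P.Lab} {S S' : ∀ k, List (tm.Γ k)}
    {A C D A' C' D' : List (Q × Γ₁)} {O O' : List Γ₂}
    (h : P.Run tm e n l S A C D O l' S' A' C' D' O') (hn : n ≤ n') :
    P.Run tm e n' l S A C D O l' S' A' C' D' O' := fun p => by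
  obtain ⟨p', ⟨t⟩⟩ := h p
  exact ⟨p', ⟨⟨t.toEvalsTo, t.steps_le_m.trans hn⟩⟩⟩

theorem Run.trans {n₁ n₂ n : ℕ} {l l' l'' : P.Lab} {S S' S'' : ∀ k, List (tm.Γ k)}
    {A C D A' C' D' A'' C'' D'' : List (Q × Γ₁)} {O O' O'' : List Γ₂}
    (h₁ : P.Run tm e n₁ l S A C D O l' S' A' C' D' O')
    (h₂ : P.Run tm e n₂ l' S' A' C' D' O' l'' S'' A'' C'' D'' O'') (hn : n₁ + n₂ ≤ n) :
    P.Run tm e n l S A C D O l'' S'' A'' C'' D'' O'' := fun p => by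
  obtain ⟨p', ⟨t₁⟩⟩ := h₁ p
  obtain ⟨p'', ⟨t₂⟩⟩ := h₂ p'
  have t := t₁.trans _ _ _ _ _ _ t₂
  exact ⟨p'', ⟨⟨t.toEvalsTo, t.steps_le_m.trans (by omega)⟩⟩⟩

theorem Run.refl (l : P.Lab) (S : ∀ k, List (tm.Γ k)) (A C D : List (Q × Γ₁)) (O : List Γ₂) :
    P.Run tm e 0 l S A C D O l S A C D O :=
  fun p => ⟨p, ⟨StateTransition.EvalsToInTime.refl _ _⟩⟩

theorem Run.single {l l' : P.Lab} {S S' : ∀ k, List (tm.Γ k)} {A C D A' C' D' : List (Q × Γ₁)}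
    {O O' : List Γ₂}
    (h : ∀ p, ∃ p', TM2.stepAux (P.prog tm e l) (tm.initialState, p) (stks tm S A C D O) =
      ⟨some (.inr l'), (tm.initialState, p'), stks tm S' A' C' D' O'⟩) :
    P.Run tm e 1 l S A C D O l' S' A' C' D' O' := fun p => by
  obtain ⟨p', hp⟩ := h p
  exact ⟨p', ⟨⟨⟨1, congrArg some hp⟩, le_rfl⟩⟩⟩

/-- The jump target depends on the popped letter, and is passed to the `goto` through the second
component of the state. That component is scratch space, hence the quantifiers over it in `Run`. -/
theorem Run.pop {l l' : P.Lab} {k : tm.K ⊕ Stack} {F : Option (Alph Q Γ₁ Γ₂ tm k) → P.Lab}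
    {S S' : ∀ k, List (tm.Γ k)} {A C D A' C' D' : List (Q × Γ₁)} {O O' : List Γ₂}
    (hF : P.prog tm e l = P.popGoto tm k F)
    (hS : update (stks tm S A C D O) k (stks tm S A C D O k).tail = stks tm S' A' C' D' O')
    (hl : F (stks tm S A C D O k).head? = l') :
    P.Run tm e 1 l S A C D O l' S' A' C' D' O' :=
  Run.single fun p => ⟨l', by simp only [hF, popGoto, TM2.stepAux, hS, hl]⟩

theorem run_read (q : Q) (w : List (tm.Γ tm.k₁)) (A : List (Q × Γ₁)) :
    P.Run tm e (2 * w.length + 1) (.read q) (haltList tm w).stk A [] [] []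
      .collect (haltList tm []).stk ((P.annotate q (w.map e)).reverse ++ A) [] [] [] := by
  induction w generalizing q A with
  | nil =>
    refine Run.pop rfl ((update_inl ..).trans ?_) ?_
    · simp only [stks, stk_haltList_self, update_haltList]; rfl
    · simp only [stks, stk_haltList_self]; rfl
  | cons x w ih =>
    have h₁ : P.Run tm e 1 (.read q) (haltList tm (x :: w)).stk A [] [] []
        (.keep q (e x)) (haltList tm w).stk A [] [] [] := by
      refine Run.pop rfl ((update_inl ..).trans ?_) ?_
      · simp only [stks, stk_haltList_self, update_haltList]; rfl
      · simp only [stks, stk_haltList_self]; rfl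
    have h₂ : P.Run tm e 1 (.keep q (e x)) (haltList tm w).stk A [] [] []
        (.read (P.next q (e x))) (haltList tm w).stk ((q, e x) :: A) [] [] [] := by
      refine Run.single fun p => ⟨p, ?_⟩
      simp only [prog, TM2.stepAux, update_todo]
      rfl
    simpa [annotate] using (h₁.trans h₂ le_rfl).trans (ih (P.next q (e x)) ((q, e x) :: A))
      (n := 2 * (x :: w).length + 1) (by simp; omega)

variable (S : ∀ k, List (tm.Γ k))

theorem run_down (j : Fin (P.passes.length + 1)) (A C D : List (Q × Γ₁)) (O : List Γ₂) :
    P.Run tm e (2 * C.length + 1) (.down j) S A C D O (.up j) S A [] (C.reverse ++ D) O := by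
  induction C generalizing D with
  | nil =>
    exact Run.pop rfl (update_block ..) rfl
  | cons x C ih =>
    have h₁ : P.Run tm e 1 (.down j) S A (x :: C) D O (.downPush j x) S A C D O :=
      Run.pop rfl (update_block ..) rfl
    have h₂ : P.Run tm e 1 (.downPush j x) S A C D O (.down j) S A C (x :: D) O := by
      refine Run.single fun p => ⟨p, ?_⟩
      simp only [prog, TM2.stepAux, update_aux]
      rfl
    simpa using (h₁.trans h₂ le_rfl).trans (ih (x :: D)) (n := 2 * (x :: C).length + 1)
      (by simp; omega)

theorem run_up_zero (A C D : List (Q × Γ₁)) (O : List Γ₂) :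
    P.Run tm e (2 * D.length + 1) (.up 0) S A C D O .collect S A C [] O := by
  induction D with
  | nil =>
    exact Run.pop rfl (update_aux ..) rfl
  | cons x D ih =>
    have h₁ : P.Run tm e 1 (.up 0) S A C (x :: D) O (.upPush 0 x) S A C D O :=
      Run.pop rfl (update_aux ..) rfl
    have h₂ : P.Run tm e 1 (.upPush 0 x) S A C D O (.up 0) S A C D O := by
      refine Run.single fun p => ⟨p, ?_⟩
      simp only [prog, if_pos, TM2.stepAux]
    exact (h₁.trans h₂ le_rfl).trans ih (by simp; omega)

/-- The auxiliary stack holds the block with its last letter on top. Letters thus return from last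
to first, and pushing their images leaves the image of the whole block in reading order on the
output stack. -/
theorem run_up_succ (j : ℕ) (hj : j + 1 < P.passes.length + 1) (A C D : List (Q × Γ₁))
    (O : List Γ₂) :
    P.Run tm e (2 * D.length + 1) (.up ⟨j + 1, hj⟩) S A C D O
      (.down ⟨j, by omega⟩) S A (D.reverse ++ C) [] (D.reverse.flatMap (P.pass (j + 1)) ++ O) := by
  have hne : (⟨j + 1, hj⟩ : Fin (P.passes.length + 1)) ≠ 0 := by
    simp [Fin.ext_iff]
  induction D generalizing C O with
  | nil =>
    exact Run.pop rfl (update_aux ..) (if_neg (t := Label.collect) hne)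
  | cons x D ih =>
    have h₁ : P.Run tm e 1 (.up ⟨j + 1, hj⟩) S A C (x :: D) O (.upPush ⟨j + 1, hj⟩ x) S A C D O :=
      Run.pop rfl (update_aux ..) rfl
    have h₂ : P.Run tm e 1 (.upPush ⟨j + 1, hj⟩ x) S A C D O
        (.up ⟨j + 1, hj⟩) S A (x :: C) D (P.pass (j + 1) x ++ O) := by
      refine Run.single fun p => ⟨p, ?_⟩
      simp only [prog, if_neg hne, TM2.stepAux, update_block, stepAux_pushOut, List.reverse_reverse]
      rfl
    simpa using (h₁.trans h₂ le_rfl).trans (ih (x :: C) (P.pass (j + 1) x ++ O))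
      (n := 2 * (x :: D).length + 1) (by simp; omega)

/-- The output is a stack, so the last pass is executed first. The round with index 0 emits nothing
and only discards the block. -/
theorem run_passes (j : ℕ) (hj : j < P.passes.length + 1) (A b : List (Q × Γ₁)) (O : List Γ₂) :
    P.Run tm e ((j + 1) * (4 * b.length + 2)) (.down ⟨j, hj⟩) S A b [] O
      .collect S A [] [] (P.image j b ++ O) := by
  induction j generalizing O with
  | zero =>
    have h := (run_down (P := P) (e := e) S ⟨0, hj⟩ A b [] O).trans
      (run_up_zero S A [] (b.reverse ++ []) O) le_rfl
    exact h.mono (by simp; omega)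
  | succ j ih =>
    have h := (run_down (P := P) (e := e) S ⟨j + 1, hj⟩ A b [] O).trans
      (run_up_succ S j hj A [] (b.reverse ++ []) O) le_rfl
    simp only [List.append_nil, List.reverse_reverse, List.length_reverse] at h
    rw [image_succ j b (by omega), List.append_assoc]
    exact h.trans (ih _ _) (by rw [Nat.succ_mul (j + 1)]; omega)

theorem run_stash (A C l : List (Q × Γ₁)) (O : List Γ₂) (hl : ∀ x ∈ l, P.isStart x = false) :
    P.Run tm e (2 * l.length) .collect S (l ++ A) C [] O
      .collect S A (l.reverse ++ C) [] O := by
  induction l generalizing C with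
  | nil => exact Run.refl _ _ _ _ _ _
  | cons x l ih =>
    have h₁ : P.Run tm e 1 .collect S (x :: l ++ A) C [] O (.stash x) S (l ++ A) C [] O := Run.pop rfl (update_todo ..) rfl
    have h₂ : P.Run tm e 1 (.stash x) S (l ++ A) C [] O .collect S (l ++ A) (x :: C) [] O := by
      refine Run.single fun p => ⟨p, ?_⟩
      simp only [prog, TM2.stepAux, update_block, hl x (by simp)]
      rfl
    simpa using (h₁.trans h₂ le_rfl).trans (ih (x :: C) fun y hy => hl y (by simp [hy]))
      (n := 2 * (x :: l).length) (by simp; omega)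

theorem run_block (A b : List (Q × Γ₁)) (O : List Γ₂) (hb : P.IsBlock b) :
    P.Run tm e (b.length * (6 * P.passes.length + 8)) .collect S (b.reverse ++ A) [] [] O
      .collect S A [] [] (P.image P.passes.length b ++ O) := by
  obtain ⟨c, l, rfl, hc, hl⟩ := hb
  have h₀ := run_stash (P := P) (e := e) S (c :: A) [] l.reverse O (by simpa using hl)
  have h₁ : P.Run tm e 1 .collect S (c :: A) l [] O (.stash c) S A l [] O := Run.pop rfl (update_todo ..) rfl
  have h₂ : P.Run tm e 1 (.stash c) S A l [] O (.down (Fin.last _)) S A (c :: l) [] O := by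
    refine Run.single fun p => ⟨p, ?_⟩
    simp only [prog, TM2.stepAux, update_block, hc, if_true]
    rfl
  have h₃ := run_passes (P := P) (e := e) S P.passes.length (by omega) A (c :: l) O
  simp only [List.reverse_reverse, List.append_nil, List.length_reverse] at h₀
  have := ((h₀.trans h₁ le_rfl).trans h₂ le_rfl).trans h₃ (le_refl _)
  rw [List.reverse_cons, List.append_assoc]
  refine this.mono ?_
  simp only [List.length_cons]
  -- With n ≥ 1 letters and p passes the cost is 2n + (p + 1)(4n + 2), which is at most n(6p + 8)
  -- because a block is nonempty.
  nlinarith [Nat.zero_le (l.length * P.passes.length)]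

theorem run_blocks (bs : List (List (Q × Γ₁))) (hbs : ∀ b ∈ bs, P.IsBlock b) (O : List Γ₂) :
    P.Run tm e (bs.flatten.length * (6 * P.passes.length + 8)) .collect S bs.flatten.reverse [] [] O
      .collect S [] [] [] (bs.flatMap (P.image P.passes.length) ++ O) := by
  -- The end of the string lies on top of the stack, so the last block is processed first.
  induction bs using List.reverseRecOn generalizing O with
  | nil => exact Run.mono (Run.refl _ _ _ _ _ _) (Nat.zero_le _)
  | append_singleton bs b ih =>
    have h := (run_block (P := P) (e := e) S bs.flatten.reverse b O (hbs b (by simp))).trans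
      (ih (fun b' hb' => hbs b' (by simp [hb'])) _) (le_refl _)
    simp only [List.flatten_append, List.flatten_cons, List.flatten_nil, List.append_nil,
      List.reverse_append, List.flatMap_append, List.flatMap_cons, List.flatMap_nil,
      List.append_assoc, List.length_append] at h ⊢
    exact h.mono (by rw [Nat.add_mul]; omega)

theorem haltList_machine (w : List Γ₂) :
    haltList (P.machine tm e) w = (⟨none, (tm.initialState, .read P.init),
      stks tm (haltList tm []).stk [] [] [] w⟩ :
        TM2.Cfg (Alph Q Γ₁ Γ₂ tm) (tm.Λ ⊕ P.Lab) (tm.σ × P.Lab)) := by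
  unfold haltList
  congr 1
  funext k
  rcases k with k | k
  · rw [dif_neg (by rintro ⟨⟩)]
    by_cases h : k = tm.k₁
    · subst h; simp [stks]; rfl
    · simp [stks, h]; rfl
  · cases k
    · exact dif_neg (by rintro ⟨⟩)
    · exact dif_neg (by rintro ⟨⟩)
    · exact dif_neg (by rintro ⟨⟩)
    · exact dif_pos rfl

theorem initList_machine (w : List (tm.Γ tm.k₀)) :
    (initList (P.machine tm e) w) = (⟨some (.inl tm.main), (tm.initialState, .read P.init),
      stks tm (initList tm w).stk [] [] [] []⟩ :
        TM2.Cfg (Alph Q Γ₁ Γ₂ tm) (tm.Λ ⊕ P.Lab) (tm.σ × P.Lab)) := by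
  unfold initList
  congr 1
  funext k
  rcases k with k | k
  · by_cases h : k = tm.k₀
    · subst h
      simp only [stks, dif_pos]
      exact dif_pos rfl
    · simp only [stks, dif_neg h]
      exact dif_neg (fun h' => h (Sum.inl.inj h'))
  · cases k <;> exact dif_neg (by rintro ⟨⟩)

end PostProc

/-- A function is computable in polynomial time if its encoded values arise from those of such a
function by post-processing. -/
theorem PolyTime.postProc {α β β' Γ₀ Γ₁ Γ₂ Q : Type} [Fintype Γ₁] [Fintype Q]
    {ea : α → List Γ₀} {eb : β → List Γ₁} {eb' : β' → List Γ₂} {f : α → β} {f' : α → β'}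
    (hf : PolyTime ea eb f) (P : PostProc Q Γ₁ Γ₂) (blocks : α → List (List (Q × Γ₁)))
    (hblocks : ∀ a, P.annotate P.init (eb (f a)) = (blocks a).flatten)
    (hisBlock : ∀ a, ∀ b ∈ blocks a, P.IsBlock b)
    (himage : ∀ a, eb' (f' a) = (blocks a).flatMap fun b => P.passes.flatMap fun h => b.flatMap h) :
    PolyTime ea eb' f' := by
  obtain ⟨M⟩ := hf
  obtain ⟨⟨tm, ei, eo⟩, time, out⟩ := M
  let _ := tm.ΛFin
  let B := ∑ l, pushCount (tm.m l)
  have hB : ∀ l, pushCount (tm.m l) ≤ B := fun l =>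
    Finset.single_le_sum (f := fun l => pushCount (tm.m l)) (fun _ _ => Nat.zero_le _)
      (Finset.mem_univ l)
  -- Cost per letter: 6p + 8 for its block and 2 for reading it. The additive 3 in the time bound
  -- covers the end of reading, the final look at the empty stack, and halting.
  let c := 6 * P.passes.length + 10
  refine ⟨⟨⟨P.machine tm eo, ei, Equiv.refl _⟩,
    time + (Polynomial.X + Polynomial.C B * time) * Polynomial.C c + 3,
    fun a => Classical.choice ?_⟩⟩
  obtain ⟨⟨n, hn⟩, hle⟩ := out a
  change n ≤ time.eval (ea a).length at hle
  set w := List.map eo.invFun (eb (f a)) with hw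
  have hlen : w.length ≤ (ea a).length + B * time.eval (ea a).length := by
    have := length_iterate_step_le tm B hB tm.k₁ n _ _ hn
    rw [PostProc.stk_haltList_self] at this
    refine this.trans (add_le_add ?_ (Nat.mul_le_mul_left _ hle))
    -- The output stack may be the input stack, in which case it does not start empty but holds the
    -- encoded input.
    by_cases h : tm.k₁ = tm.k₀
    · generalize hs : List.map ei.invFun (ea a) = s
      have hs' : s.length = (ea a).length := by rw [← hs, List.length_map]
      rw [← hs']
      obtain ⟨k₀, k₁, Γ, Λ, main, σ, ini, m⟩ := tm
      dsimp at h
      subst h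
      simp [initList]
    · simp [initList, h]
  have h₁ := P.iterate_liftCfg tm eo (.read P.init) n _ _ hn
  have h₂ : P.Run tm eo (2 * w.length + 1 + w.length * (6 * P.passes.length + 8))
      (.read P.init) (haltList tm w).stk [] [] [] [] .collect (haltList tm []).stk
      [] [] [] (eb' (f' a)) := by
    have hr := PostProc.run_read (P := P) (e := eo) P.init w []
    have hwe : w.map eo = eb (f a) := by simp [hw]
    have hfl : w.length = (blocks a).flatten.length := by
      rw [← hblocks, PostProc.length_annotate, hw, List.length_map]
    rw [hwe, hblocks, List.append_nil] at hr
    have hbs := PostProc.run_blocks (P := P) (e := eo) (haltList tm []).stk (blocks a)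
      (hisBlock a) []
    have him : (blocks a).flatMap (P.image P.passes.length) = eb' (f' a) := by
      rw [himage]
      unfold PostProc.image
      rw [List.take_length]
    rw [him, List.append_nil, ← hfl] at hbs
    exact hr.trans hbs le_rfl
  have h₃ : P.Run tm eo 1 .collect (haltList tm []).stk [] [] [] (eb' (f' a))
      .finish (haltList tm []).stk [] [] [] (eb' (f' a)) := by
    exact PostProc.Run.pop rfl (PostProc.update_todo ..) rfl
  obtain ⟨p', ⟨t⟩⟩ := (h₂.trans h₃ le_rfl) (.read P.init)
  have t₁ : StateTransition.EvalsToInTime (P.machine tm eo).step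
      (initList (P.machine tm eo) (List.map ei.invFun (ea a)))
      (some (P.cfg tm eo (.read P.init) (.read P.init) (haltList tm w).stk [] [] [] [])) n :=
    ⟨⟨n, (congrArg (fun c => (flip bind (P.machine tm eo).step)^[n] (some c))
      (PostProc.initList_machine _)).trans h₁⟩, le_rfl⟩
  have t₂ : StateTransition.EvalsToInTime (P.machine tm eo).step
      (P.cfg tm eo .finish p' (haltList tm []).stk [] [] [] (eb' (f' a)))
      (some (haltList (P.machine tm eo) (eb' (f' a)))) 1 :=
    ⟨⟨1, by rw [PostProc.haltList_machine]; rfl⟩, le_rfl⟩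
  have t₃ := (t₁.trans _ _ _ _ _ _ t).trans _ _ _ _ _ _ t₂
  have hmap : List.map (Equiv.refl Γ₂).invFun (eb' (f' a)) = eb' (f' a) := List.map_id _
  refine ⟨⟨⟨t₃.steps, ?_⟩, t₃.steps_le_m.trans ?_⟩⟩
  · refine t₃.evals_in_steps.trans ?_
    exact congrArg (fun s => some (haltList (P.machine tm eo) s)) hmap.symm
  · simp only [Polynomial.eval_add, Polynomial.eval_mul, Polynomial.eval_X, Polynomial.eval_C,
      Polynomial.eval_ofNat]
    have := Nat.mul_le_mul_right c hlen
    have hc : w.length * c = w.length * (6 * P.passes.length + 8) + 2 * w.length := by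
      simp only [c]; ring
    omega

end CleanDB

namespace CleanDB

/-! ### Reductions given by templates -/

/-- The first constant of a fact over the binary relation symbol. -/
def constA (f : Fact sigZero) : Const := f.2 (0 : Fin 2)

/-- The second constant of a fact over the binary relation symbol. -/
def constB (f : Fact sigZero) : Const := f.2 (1 : Fin 2)

/-- A constant that codes a tag, and optionally the constants `a` and `b`. -/
def attrValue (ℓ : ℕ × Bool × Bool) (a b : Const) : Const :=
  (if ℓ.2.1 then a.flatMap (fun x => [true, x]) else []) ++ [false, ℓ.2.1] ++
    ((if ℓ.2.2 then b.flatMap (fun x => [true, x]) else []) ++ [false, ℓ.2.2]) ++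
      List.replicate ℓ.1 true

/-- The code is self-delimiting: data bits are announced by `true`, the end by `false`, so the two
parses proceed in parallel. -/
theorem flatMap_marked_inj {a a' : Const} {u u' : Bool} {r r' : List Bool}
    (h : a.flatMap (fun x => [true, x]) ++ ([false, u] ++ r) =
      a'.flatMap (fun x => [true, x]) ++ ([false, u'] ++ r')) : a = a' ∧ u = u' ∧ r = r' := by
  induction a generalizing a' with
  | nil =>
    cases a' with
    | nil => simpa using h
    | cons x a' => simp at h
  | cons y a ih =>
    cases a' with
    | nil => simp at h
    | cons x a' =>
      simp only [List.flatMap_cons, List.cons_append, List.nil_append, List.cons.injEq,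
        true_and] at h
      obtain ⟨rfl, h⟩ := h
      obtain ⟨rfl, hu, hr⟩ := ih h
      exact ⟨rfl, hu, hr⟩

theorem attrValue_inj {ℓ ℓ' : ℕ × Bool × Bool} {a b a' b' : Const} :
    attrValue ℓ a b = attrValue ℓ' a' b' ↔
      ℓ = ℓ' ∧ (ℓ.2.1 = true → a = a') ∧ (ℓ.2.2 = true → b = b') := by
  constructor
  · obtain ⟨n, u, v⟩ := ℓ
    obtain ⟨n', u', v'⟩ := ℓ'
    intro h
    -- A constant that is not used is coded like the empty constant, distinguished by the flag; both
    -- fields then have the self-delimiting form.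
    have key : ∀ (u : Bool) (a : Const), (if u then a.flatMap (fun x => [true, x]) else []) =
        (if u then a else []).flatMap (fun x => [true, x]) := by
      intro u a; cases u <;> rfl
    simp only [attrValue, key, List.append_assoc] at h
    obtain ⟨ha, hu, h⟩ := flatMap_marked_inj h
    obtain ⟨hb, hv, hn⟩ := flatMap_marked_inj h
    subst hu hv
    have := congrArg List.length hn
    simp only [List.length_replicate] at this
    subst this
    refine ⟨rfl, ?_, ?_⟩
    · rintro rfl; simpa using ha
    · rintro rfl; simpa using hb
  · rintro ⟨rfl, ha, hb⟩
    obtain ⟨n, u, v⟩ := ℓ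
    cases u <;> cases v <;> simp_all [attrValue]

/-- A template for the facts over a relation symbol of arity `k`: every attribute is assigned a tag
and the information which constants of the given binary fact are used. -/
abbrev Template (k : ℕ) : Type := Fin k → ℕ × Bool × Bool

/-- The tuple obtained from a binary fact by means of a template. -/
def Template.tuple {k : ℕ} (τ : Template k) (f : Fact sigZero) (j : Fin k) : Const :=
  attrValue (τ j) (constA f) (constB f)

/-- The fact obtained from a binary fact by means of a template. -/
def Template.fact {σ : Signature} {R : Fin σ.num} (τ : Template (σ.arity R)) (f : Fact sigZero) :
    Fact σ :=
  ⟨R, τ.tuple f⟩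

theorem Template.fact_inj {σ : Signature} {R : Fin σ.num} {τ τ' : Template (σ.arity R)}
    {f g : Fact sigZero} : τ.fact f = τ'.fact g ↔ τ.tuple f = τ'.tuple g := by
  simp only [Template.fact, Sigma.mk.injEq, heq_eq_eq, true_and]

theorem encodeFact_sigZero (f : Fact sigZero) :
    encodeFact f = encodeConst (constA f) ++ encodeConst (constB f) ++ [Token.endFact] := by
  obtain ⟨R, t⟩ := f
  have hR : R = 0 := Subsingleton.elim (α := Fin 1) R 0
  subst hR
  simp [encodeFact, constA, constB]

theorem endInstance_notMem_encodeFact {σ : Signature} (f : Fact σ) :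
    Token.endInstance ∉ encodeFact f := by
  simp [encodeFact, encodeConst]

theorem PostProc.annotate_append {Q Γ₁ Γ₂ : Type} (P : PostProc Q Γ₁ Γ₂) (q : Q) (u v : List Γ₁) :
    P.annotate q (u ++ v) = P.annotate q u ++ P.annotate (u.foldl P.next q) v := by
  induction u generalizing q with
  | nil => rfl
  | cons x u ih => simp [PostProc.annotate, ih]

/-! #### Duplicating the facts -/

/-- The transformation that repeats the list of facts after the end marker, and marks the letters of
the three parts. -/
def duplicator : PostProc (Fin 3) Token (Fin 3 × Token) where
  init := 0
  next q t := if t = .endInstance then 2 else if q = 0 then 1 else q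
  isStart x := decide (x.1 = 0)
  passes :=
    [fun x => if x.1 = 2 then [] else [(0, x.2)],
     fun x => if x.1 = 2 then [(2, x.2)] else if x.2 = .endInstance then [] else [(1, x.2)]]

/-- The initial state is never re-entered, so only the first letter starts a block and the whole
string is one block. -/
theorem duplicator_next_ne_zero (q : Fin 3) (t : Token) : duplicator.next q t ≠ 0 := by
  by_cases h : t = .endInstance
  · simp [duplicator, h]
  · by_cases h' : q = 0 <;> simp [duplicator, h, h']

theorem isStart_annotate_duplicator (q : Fin 3) (hq : q ≠ 0) (w : List Token) :
    ∀ x ∈ duplicator.annotate q w, duplicator.isStart x = false := by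
  induction w generalizing q with
  | nil => simp [PostProc.annotate]
  | cons t w ih =>
    intro x hx
    rcases List.mem_cons.1 hx with rfl | hx
    · simpa [duplicator] using hq
    · exact ih _ (duplicator_next_ne_zero q t) x hx

theorem isBlock_annotate_duplicator (w : List Token) (hw : w ≠ []) :
    duplicator.IsBlock (duplicator.annotate 0 w) := by
  obtain ⟨t, w, rfl⟩ := List.exists_cons_of_ne_nil hw
  exact ⟨_, _, rfl, rfl, isStart_annotate_duplicator _ (duplicator_next_ne_zero 0 t) w⟩

theorem annotate_duplicator_two (v : List Token) :
    duplicator.annotate 2 v = v.map fun t => (2, t) := by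
  induction v with
  | nil => rfl
  | cons t v ih =>
    have : duplicator.next 2 t = 2 := by simp [duplicator]
    simp [PostProc.annotate, this, ih]

/-- State 2 holds exactly after the end marker, so the state tells facts from priorities. The claim
is for any `q ≠ 2` because the first letter is read in state 0 and the later ones in state 1. -/
theorem image_duplicator (q : Fin 3) (hq : q ≠ 2) (u v : List Token) (hu : Token.endInstance ∉ u) :
    (duplicator.annotate q (u ++ Token.endInstance :: v)).flatMap
        (fun x => if x.1 = 2 then [] else [((0 : Fin 3), x.2)]) =
      u.map (fun t => (0, t)) ++ [(0, Token.endInstance)] ∧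
    (duplicator.annotate q (u ++ Token.endInstance :: v)).flatMap
        (fun x => if x.1 = 2 then [((2 : Fin 3), x.2)] else if x.2 = .endInstance then []
          else [(1, x.2)]) =
      u.map (fun t => (1, t)) ++ v.map (fun t => (2, t)) := by
  induction u generalizing q with
  | nil =>
    have : duplicator.next q .endInstance = 2 := by simp [duplicator]
    constructor
    · simp [PostProc.annotate, this, annotate_duplicator_two, hq, List.flatMap_map]
    · simp [PostProc.annotate, this, annotate_duplicator_two, hq, List.flatMap_map,
        ← List.map_eq_flatMap]
  | cons t u ih =>
    have ht : t ≠ .endInstance := fun h => hu (by simp [h])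
    have hn : duplicator.next q t ≠ 2 := by
      by_cases h' : q = 0 <;> simp [duplicator, ht, h', hq]
    obtain ⟨h₁, h₂⟩ := ih _ hn fun h => hu (by simp [h])
    constructor
    · simp [PostProc.annotate, hq, h₁]
    · simp [PostProc.annotate, hq, ht, h₂]

/-- The intermediate string of a template reduction. -/
def markedInput (D : Input schemaZero) : List (Fin 3 × Token) :=
  ((D.facts.flatMap encodeFact).map fun t => ((0 : Fin 3), t)) ++ [(0, Token.endInstance)] ++
    (((D.facts.flatMap encodeFact).map fun t => ((1 : Fin 3), t)) ++
      (D.pairs.flatMap fun p => encodeFact p.1 ++ encodeFact p.2).map fun t => ((2 : Fin 3), t))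

/-- The facts are needed twice in the target, for its facts and for the priorities between nodes of
one fact. These lie on different sides of the end marker, so the list is repeated before templates
are filled in locally. -/
theorem PolyTime.markedInput {α Γ₀ : Type} {ea : α → List Γ₀} {f : α → Input schemaZero}
    (hf : PolyTime ea encodeInput f) :
    PolyTime ea (id : List (Fin 3 × Token) → _) fun x => CleanDB.markedInput (f x) := by
  refine hf.postProc duplicator (fun x => [duplicator.annotate 0 (encodeInput (f x))]) ?_ ?_ ?_
  · intro a; simp; rfl
  · intro a b hb
    rw [List.mem_singleton] at hb
    subst hb
    exact isBlock_annotate_duplicator _ (by simp [encodeInput])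
  · intro a
    have h := image_duplicator 0 (by decide) ((f a).facts.flatMap encodeFact)
      ((f a).pairs.flatMap fun p => encodeFact p.1 ++ encodeFact p.2)
      (by simp [endInstance_notMem_encodeFact])
    simp only [encodeInput, List.append_assoc, List.singleton_append, List.flatMap_singleton]
    simp only [duplicator, List.flatMap_cons, List.flatMap_nil, List.append_nil]
    exact (congrArg₂ (· ++ ·) h.1 h.2).symm

/-! #### Filling in the templates -/

/-- A position in a block: whether it is the start of the block, whether it is in the second fact of
a pair, and the number of constants of the fact that precede it. -/
abbrev Pos : Type := Bool × Bool × Fin 3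

/-- The letters of an annotated marked input. -/
abbrev Letter : Type := Pos × Fin 3 × Token

/-- The position after a letter. -/
def nextPos (q : Pos) (x : Fin 3 × Token) : Pos :=
  match x.2 with
  | .endConst => (false, q.2.1, q.2.2 + 1)
  | .endFact => if x.1 = 2 ∧ q.2.1 = false then (false, true, 0) else (true, false, 0)
  | .endInstance => (true, false, 0)
  | _ => (false, q.2)

/-- Apply `p` to the letters of the part `s` that belong to the first or second fact. -/
def emit (s : Fin 3) (snd : Bool) (p : Fin 3 → Token → List Token) (x : Letter) : List Token :=
  if x.2.1 = s ∧ x.1.2.1 = snd then p x.1.2.2 x.2.2 else []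

/-- The contribution of a letter to the prefix for the relation symbol with index `r`. -/
def emitRel (r : ℕ) : Fin 3 → Token → List Token
  | 2, .endFact => List.replicate r .rel
  | _, _ => []

/-- The contribution of a letter to the end marker of a fact. -/
def emitEnd : Fin 3 → Token → List Token
  | 2, .endFact => [.endFact]
  | _, _ => []

/-- The contribution of a letter to an attribute value. -/
def emitAttr (ℓ : ℕ × Bool × Bool) : Fin 3 → Token → List Token
  | 0, .bit x => if ℓ.2.1 then [.bit true, .bit x] else []
  | 0, .endConst => [.bit false, .bit ℓ.2.1]
  | 1, .bit x => if ℓ.2.2 then [.bit true, .bit x] else []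
  | 1, .endConst => [.bit false, .bit ℓ.2.2]
  | 2, .endFact => List.replicate ℓ.1 (.bit true) ++ [.endConst]
  | _, _ => []

/-- The passes that write the fact given by a template. -/
def factPasses {σ : Signature} {R : Fin σ.num} (s : Fin 3) (snd : Bool)
    (τ : Template (σ.arity R)) : List (Letter → List Token) :=
  emit s snd (emitRel R) :: ((List.ofFn fun j => emit s snd (emitAttr (τ j))) ++
    [emit s snd emitEnd])

/-- The pass that writes the end marker of the instance. -/
def markerPass (x : Letter) : List Token :=
  if x.2.2 = .endInstance then [.endInstance] else []

/-- The transformation that fills in templates: `T₁` for the facts, `T₂` for the priorities between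
facts that arise from the same fact, and `T₃` for those that arise from a priority. -/
def filler {σ : Signature} {R : Fin σ.num} (T₁ : List (Template (σ.arity R)))
    (T₂ T₃ : List (Template (σ.arity R) × Template (σ.arity R))) :
    PostProc Pos (Fin 3 × Token) Token where
  init := (true, false, 0)
  next := nextPos
  isStart x := x.1.1
  passes := T₁.flatMap (factPasses 0 false) ++ markerPass ::
    (T₂.flatMap (fun t => factPasses 1 false t.1 ++ factPasses 1 false t.2) ++
      T₃.flatMap fun t => factPasses 2 false t.1 ++ factPasses 2 true t.2)

/-- The annotated letters of a fact, up to the mark at the start of a block. -/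
def segment (s : Fin 3) (snd : Bool) (f : Fact sigZero) : List Letter :=
  (encodeConst (constA f)).map (fun t => ((false, snd, 0), (s, t))) ++
    ((encodeConst (constB f)).map (fun t => ((false, snd, 1), (s, t))) ++
      [((false, snd, 2), (s, .endFact))])

/-- What the letters of a fact contribute in a pass. -/
def contribution (p : Fin 3 → Token → List Token) (f : Fact sigZero) : List Token :=
  (encodeConst (constA f)).flatMap (p 0) ++ ((encodeConst (constB f)).flatMap (p 1) ++ p 2 .endFact)

theorem flatMap_emit_segment (s s' : Fin 3) (snd snd' : Bool) (p : Fin 3 → Token → List Token)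
    (f : Fact sigZero) :
    (segment s snd f).flatMap (emit s' snd' p) =
      if s = s' ∧ snd = snd' then contribution p f else [] := by
  by_cases h : s = s' ∧ snd = snd'
  · obtain ⟨rfl, rfl⟩ := h
    simp [segment, contribution, List.flatMap_map, emit]
  · simp [segment, List.flatMap_map, emit, h]

theorem flatMap_const_nil {α β : Type*} (l : List α) :
    (l.flatMap fun _ => ([] : List β)) = [] :=
  List.flatMap_eq_nil_iff.2 fun _ _ => rfl

theorem contribution_emitRel (r : ℕ) (f : Fact sigZero) :
    contribution (emitRel r) f = List.replicate r .rel := by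
  simp [contribution, emitRel, encodeConst, List.flatMap_map, flatMap_const_nil]

theorem contribution_emitEnd (f : Fact sigZero) :
    contribution emitEnd f = [.endFact] := by
  simp [contribution, emitEnd, encodeConst, List.flatMap_map, flatMap_const_nil]

theorem contribution_emitAttr (ℓ : ℕ × Bool × Bool) (f : Fact sigZero) :
    contribution (emitAttr ℓ) f = encodeConst (attrValue ℓ (constA f) (constB f)) := by
  obtain ⟨n, u, v⟩ := ℓ
  have key : ∀ (u : Bool) (a : Const), (a.flatMap fun x => if u = true then
      [Token.bit true, Token.bit x] else []) =
      (if u = true then a.flatMap (fun x => [true, x]) else []).map Token.bit := by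
    intro u a; cases u <;> simp [List.map_flatMap]
  simp [contribution, emitAttr, encodeConst, attrValue, List.flatMap_map, key]

/-- The block enters only through `hB`, so that the same statement serves blocks of one fact and
blocks of a pair of facts. -/
theorem flatMap_factPasses {σ : Signature} {R : Fin σ.num} (s : Fin 3) (snd : Bool)
    (τ : Template (σ.arity R)) (f : Fact sigZero) (B : List Letter)
    (hB : ∀ p, B.flatMap (emit s snd p) = contribution p f) :
    ((factPasses s snd τ).flatMap fun h => B.flatMap h) = encodeFact (τ.fact f) := by
  have hofn : ((List.ofFn fun j => emit s snd (emitAttr (τ j))).flatMap fun h => B.flatMap h) =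
      (List.ofFn fun j => attrValue (τ j) (constA f) (constB f)).flatMap encodeConst := by
    rw [List.flatMap_def, List.flatMap_def, List.map_ofFn, List.map_ofFn]
    congr 2
    funext j
    simp [hB, contribution_emitAttr]
  simp [factPasses, hofn, hB, contribution_emitRel, contribution_emitEnd, encodeFact, Template.fact,
    show τ.tuple f = fun j => attrValue (τ j) (constA f) (constB f) from rfl]

theorem flatMap_factPasses_of_disjoint {σ : Signature} {R : Fin σ.num} (s : Fin 3) (snd : Bool)
    (τ : Template (σ.arity R)) (B : List Letter) (hB : ∀ p, B.flatMap (emit s snd p) = []) :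
    ((factPasses s snd τ).flatMap fun h => B.flatMap h) = [] := by
  refine List.flatMap_eq_nil_iff.2 fun h hh => ?_
  simp only [factPasses, List.mem_cons, List.mem_append, List.mem_ofFn, List.not_mem_nil,
    or_false] at hh
  rcases hh with rfl | ⟨j, rfl⟩ | rfl <;> exact hB _

end CleanDB

/-! ### Block decomposition of the marked input, and the image of each block -/

namespace CleanDB

/-- Mark the first letter as the start of a block. -/
def setStart : List Letter → List Letter
  | [] => []
  | x :: l => ((true, x.1.2), x.2) :: l

theorem flatMap_setStart (h : Letter → List Token) (hh : ∀ b q x, h ((b, q), x) = h ((true, q), x))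
    (l : List Letter) : (setStart l).flatMap h = l.flatMap h := by
  cases l with
  | nil => rfl
  | cons x l =>
    obtain ⟨⟨b, q⟩, x⟩ := x
    simp [setStart, hh b q x]

section Filler

variable {σ : Signature} {R : Fin σ.num} {T₁ : List (Template (σ.arity R))}
  {T₂ T₃ : List (Template (σ.arity R) × Template (σ.arity R))}

/-- The start flag has no influence on later positions, so it can be set aside while annotating and
restored on the first letter. -/
theorem annotate_filler_start (q : Bool × Fin 3) (w : List (Fin 3 × Token)) :
    (filler T₁ T₂ T₃).annotate (true, q) w = setStart ((filler T₁ T₂ T₃).annotate (false, q) w) := by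
  cases w with
  | nil => rfl
  | cons x w =>
    have : nextPos (true, q) x = nextPos (false, q) x := by
      obtain ⟨s, t⟩ := x
      cases t <;> rfl
    simp only [PostProc.annotate, setStart]
    rw [show (filler T₁ T₂ T₃).next = nextPos from rfl, this]

theorem isBlock_setStart (l : List Letter) (hl : l ≠ []) (h : ∀ x ∈ l, x.1.1 = false) :
    (filler T₁ T₂ T₃).IsBlock (setStart l) := by
  obtain ⟨x, l, rfl⟩ := List.exists_cons_of_ne_nil hl
  exact ⟨_, _, rfl, rfl, fun y hy => h y (by simp [hy])⟩

theorem foldl_nextPos_encodeConst (s : Fin 3) (b : Bool) (snd : Bool) (k : Fin 3) (c : Const) :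
    ((encodeConst c).map fun t => (s, t)).foldl nextPos (b, snd, k) = (false, snd, k + 1) := by
  induction c generalizing b with
  | nil => rfl
  | cons x c ih => exact ih false

theorem annotate_filler_encodeConst (s : Fin 3) (snd : Bool) (k : Fin 3) (c : Const) :
    (filler T₁ T₂ T₃).annotate (false, snd, k) ((encodeConst c).map fun t => (s, t)) =
      (encodeConst c).map fun t => ((false, snd, k), (s, t)) := by
  induction c with
  | nil => rfl
  | cons x c ih => exact congrArg (((false, snd, k), (s, Token.bit x)) :: ·) ih

theorem foldl_nextPos_encodeFact (s : Fin 3) (b : Bool) (snd : Bool) (f : Fact sigZero) :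
    ((encodeFact f).map fun t => (s, t)).foldl nextPos (b, snd, 0) =
      if s = 2 ∧ snd = false then (false, true, 0) else (true, false, 0) := by
  rw [encodeFact_sigZero, List.map_append, List.map_append, List.foldl_append, List.foldl_append,
    foldl_nextPos_encodeConst, foldl_nextPos_encodeConst]
  rfl

theorem annotate_filler_encodeFact (s : Fin 3) (snd : Bool) (f : Fact sigZero) :
    (filler T₁ T₂ T₃).annotate (false, snd, 0) ((encodeFact f).map fun t => (s, t)) =
      segment s snd f := by
  rw [encodeFact_sigZero, List.map_append, List.map_append, List.append_assoc,
    PostProc.annotate_append, annotate_filler_encodeConst, PostProc.annotate_append]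
  change _ ++ (PostProc.annotate _ (((encodeConst (constA f)).map fun t => (s, t)).foldl nextPos
    (false, snd, 0)) _ ++ PostProc.annotate _ (((encodeConst (constB f)).map fun t => (s, t)).foldl
    nextPos (((encodeConst (constA f)).map fun t => (s, t)).foldl nextPos (false, snd, 0))) _) = _
  rw [foldl_nextPos_encodeConst, foldl_nextPos_encodeConst, annotate_filler_encodeConst]
  rfl

theorem segment_ne_nil (s : Fin 3) (snd : Bool) (f : Fact sigZero) : segment s snd f ≠ [] := by
  simp [segment]

theorem start_of_mem_segment (s : Fin 3) (snd : Bool) (f : Fact sigZero) :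
    ∀ x ∈ segment s snd f, x.1.1 = false := by
  intro x hx
  simp only [segment, List.mem_append, List.mem_map, List.mem_singleton] at hx
  rcases hx with ⟨t, -, rfl⟩ | ⟨t, -, rfl⟩ | rfl <;> rfl

theorem flatMap_markerPass_segment (s : Fin 3) (snd : Bool) (f : Fact sigZero) :
    (segment s snd f).flatMap markerPass = [] := by
  refine List.flatMap_eq_nil_iff.2 fun x hx => if_neg ?_
  simp only [segment, List.mem_append, List.mem_map, List.mem_singleton, encodeConst] at hx
  rcases hx with ⟨t, ht, rfl⟩ | ⟨t, ht, rfl⟩ | rfl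
  · rintro rfl; simp at ht
  · rintro rfl; simp at ht
  · simp

/-- The blocks of the annotated marked input. -/
def fillerBlocks (D : Input schemaZero) : List (List Letter) :=
  D.facts.map (fun f => setStart (segment 0 false f)) ++ [[((true, false, 0), (0, .endInstance))]] ++
    (D.facts.map (fun f => setStart (segment 1 false f)) ++
      D.pairs.map fun p => setStart (segment 2 false p.1 ++ segment 2 true p.2))

theorem annotate_filler_facts (s : Fin 3) (hs : s ≠ 2) (l : List (Fact sigZero))
    (w : List (Fin 3 × Token)) :
    (filler T₁ T₂ T₃).annotate (true, false, 0) ((l.flatMap encodeFact).map (fun t => (s, t)) ++ w) =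
      (l.map fun f => setStart (segment s false f)).flatten ++
        (filler T₁ T₂ T₃).annotate (true, false, 0) w := by
  induction l with
  | nil => rfl
  | cons f l ih =>
    rw [List.flatMap_cons, List.map_append, List.append_assoc, PostProc.annotate_append,
      annotate_filler_start, annotate_filler_encodeFact]
    change _ ++ PostProc.annotate _ (((encodeFact f).map fun t => (s, t)).foldl nextPos _) _ = _
    rw [foldl_nextPos_encodeFact, if_neg (by simp [hs]), ih]
    simp

theorem annotate_filler_pairs (l : List (Fact sigZero × Fact sigZero)) :
    (filler T₁ T₂ T₃).annotate (true, false, 0)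
        ((l.flatMap fun p => encodeFact p.1 ++ encodeFact p.2).map fun t => (2, t)) =
      (l.map fun p => setStart (segment 2 false p.1 ++ segment 2 true p.2)).flatten := by
  induction l with
  | nil => rfl
  | cons p l ih =>
    rw [List.flatMap_cons, List.map_append, PostProc.annotate_append, annotate_filler_start,
      List.map_append, PostProc.annotate_append, annotate_filler_encodeFact, List.foldl_append]
    change setStart (_ ++ PostProc.annotate _ (((encodeFact p.1).map fun t => (2, t)).foldl
      nextPos _) _) ++ PostProc.annotate _ (((encodeFact p.2).map fun t => (2, t)).foldl nextPos
      (((encodeFact p.1).map fun t => (2, t)).foldl nextPos _)) _ = _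
    rw [foldl_nextPos_encodeFact, if_pos (by simp), foldl_nextPos_encodeFact, if_pos (by simp),
      foldl_nextPos_encodeFact, if_neg (by simp), annotate_filler_encodeFact, ih]
    simp

theorem annotate_filler_markedInput (D : Input schemaZero) :
    (filler T₁ T₂ T₃).annotate (true, false, 0) (markedInput D) = (fillerBlocks D).flatten := by
  rw [markedInput, List.append_assoc, annotate_filler_facts 0 (by decide), List.singleton_append]
  simp only [PostProc.annotate]
  change _ ++ (_ :: PostProc.annotate _ (true, false, 0) _) = _
  rw [annotate_filler_facts 1 (by decide), annotate_filler_pairs]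
  simp [fillerBlocks]

theorem isBlock_of_mem_fillerBlocks (D : Input schemaZero) :
    ∀ b ∈ fillerBlocks D, (filler T₁ T₂ T₃).IsBlock b := by
  intro b hb
  simp only [fillerBlocks, List.mem_append, List.mem_map, List.mem_singleton] at hb
  rcases hb with (⟨f, -, rfl⟩ | rfl) | ⟨f, -, rfl⟩ | ⟨p, -, rfl⟩
  · exact isBlock_setStart _ (segment_ne_nil _ _ _) (start_of_mem_segment _ _ _)
  · exact ⟨_, [], rfl, rfl, by simp⟩
  · exact isBlock_setStart _ (segment_ne_nil _ _ _) (start_of_mem_segment _ _ _)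
  · refine isBlock_setStart _ (by simp [segment_ne_nil]) fun x hx => ?_
    rcases List.mem_append.1 hx with hx | hx
    · exact start_of_mem_segment _ _ _ x hx
    · exact start_of_mem_segment _ _ _ x hx

theorem flatMap_emit_setStart (s : Fin 3) (snd : Bool) (p : Fin 3 → Token → List Token)
    (l : List Letter) : (setStart l).flatMap (emit s snd p) = l.flatMap (emit s snd p) :=
  flatMap_setStart _ (fun _ _ _ => rfl) l

theorem flatMap_markerPass_setStart (l : List Letter) :
    (setStart l).flatMap markerPass = l.flatMap markerPass :=
  flatMap_setStart _ (fun _ _ _ => rfl) l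

/-- All blocks undergo the same list of passes; passes meant for another part emit nothing, which
leaves those of `T₁`. The next two lemmas do the same for `T₂` and `T₃`. -/
theorem flatMap_passes_segment_zero (f : Fact sigZero) :
    ((filler T₁ T₂ T₃).passes.flatMap fun h => (setStart (segment 0 false f)).flatMap h) =
      T₁.flatMap fun τ => encodeFact (τ.fact f) := by
  have h₁ : ∀ τ : Template (σ.arity R), ((factPasses 0 false τ).flatMap fun h =>
      (setStart (segment 0 false f)).flatMap h) = encodeFact (τ.fact f) := fun τ =>
    flatMap_factPasses _ _ _ _ _ fun p => by simp [flatMap_emit_setStart, flatMap_emit_segment]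
  have h₂ : ∀ (s : Fin 3) (snd : Bool) (τ : Template (σ.arity R)), s ≠ 0 →
      ((factPasses s snd τ).flatMap fun h => (setStart (segment 0 false f)).flatMap h) = [] :=
    fun s snd τ hs => flatMap_factPasses_of_disjoint _ _ _ _ fun p => by
      simp [flatMap_emit_setStart, flatMap_emit_segment, hs.symm]
  simp only [filler, List.flatMap_append, List.flatMap_cons, List.flatMap_assoc, h₁,
    h₂ 1 _ _ (by decide), h₂ 2 _ _ (by decide), flatMap_markerPass_setStart,
    flatMap_markerPass_segment, flatMap_const_nil, List.append_nil]

theorem flatMap_passes_segment_one (f : Fact sigZero) :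
    ((filler T₁ T₂ T₃).passes.flatMap fun h => (setStart (segment 1 false f)).flatMap h) =
      T₂.flatMap fun t => encodeFact (t.1.fact f) ++ encodeFact (t.2.fact f) := by
  have h₁ : ∀ τ : Template (σ.arity R), ((factPasses 1 false τ).flatMap fun h =>
      (setStart (segment 1 false f)).flatMap h) = encodeFact (τ.fact f) := fun τ =>
    flatMap_factPasses _ _ _ _ _ fun p => by simp [flatMap_emit_setStart, flatMap_emit_segment]
  have h₂ : ∀ (s : Fin 3) (snd : Bool) (τ : Template (σ.arity R)), s ≠ 1 →
      ((factPasses s snd τ).flatMap fun h => (setStart (segment 1 false f)).flatMap h) = [] :=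
    fun s snd τ hs => flatMap_factPasses_of_disjoint _ _ _ _ fun p => by
      simp [flatMap_emit_setStart, flatMap_emit_segment, hs.symm]
  simp only [filler, List.flatMap_append, List.flatMap_cons, List.flatMap_assoc, h₁,
    h₂ 0 _ _ (by decide), h₂ 2 _ _ (by decide), flatMap_markerPass_setStart,
    flatMap_markerPass_segment, flatMap_const_nil, List.append_nil, List.nil_append]

theorem flatMap_passes_segment_two (f g : Fact sigZero) :
    ((filler T₁ T₂ T₃).passes.flatMap fun h =>
        (setStart (segment 2 false f ++ segment 2 true g)).flatMap h) =
      T₃.flatMap fun t => encodeFact (t.1.fact f) ++ encodeFact (t.2.fact g) := by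
  have h₁ : ∀ τ : Template (σ.arity R), ((factPasses 2 false τ).flatMap fun h =>
      (setStart (segment 2 false f ++ segment 2 true g)).flatMap h) = encodeFact (τ.fact f) :=
    fun τ => flatMap_factPasses _ _ _ _ _ fun p => by
      simp [flatMap_emit_setStart, flatMap_emit_segment]
  have h₂ : ∀ τ : Template (σ.arity R), ((factPasses 2 true τ).flatMap fun h =>
      (setStart (segment 2 false f ++ segment 2 true g)).flatMap h) = encodeFact (τ.fact g) :=
    fun τ => flatMap_factPasses _ _ _ _ _ fun p => by
      simp [flatMap_emit_setStart, flatMap_emit_segment]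
  have h₃ : ∀ (s : Fin 3) (snd : Bool) (τ : Template (σ.arity R)), s ≠ 2 →
      ((factPasses s snd τ).flatMap fun h =>
        (setStart (segment 2 false f ++ segment 2 true g)).flatMap h) = [] :=
    fun s snd τ hs => flatMap_factPasses_of_disjoint _ _ _ _ fun p => by
      simp [flatMap_emit_setStart, flatMap_emit_segment, hs.symm]
  simp only [filler, List.flatMap_append, List.flatMap_cons, List.flatMap_assoc, h₁, h₂,
    h₃ 0 _ _ (by decide), h₃ 1 _ _ (by decide), flatMap_markerPass_setStart,
    flatMap_markerPass_segment, flatMap_const_nil, List.append_nil, List.nil_append]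

theorem flatMap_passes_marker :
    ((filler T₁ T₂ T₃).passes.flatMap fun h => [((true, false, 0), (0, .endInstance))].flatMap h) =
      [Token.endInstance] := by
  have h₁ : ∀ (s : Fin 3) (snd : Bool) (τ : Template (σ.arity R)),
      ((factPasses s snd τ).flatMap fun h =>
        [((true, false, 0), (0, .endInstance))].flatMap h) = [] := by
    intro s snd τ
    rw [factPasses]
    refine List.flatMap_eq_nil_iff.2 fun h hh => ?_
    simp only [List.mem_cons, List.mem_append, List.mem_ofFn, List.not_mem_nil, or_false] at hh
    rcases hh with rfl | ⟨j, rfl⟩ | rfl <;> simp [emit, emitRel, emitAttr, emitEnd]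
  simp only [filler, List.flatMap_append, List.flatMap_cons, List.flatMap_assoc] at h₁ ⊢
  simp only [h₁, flatMap_const_nil, List.append_nil, List.nil_append]
  rfl

end Filler

/-- The facts and the priorities that arise from templates can be computed in polynomial time. -/
theorem PolyTime.template {α Γ₀ : Type} {ea : α → List Γ₀} {f : α → Input schemaZero}
    (hf : PolyTime ea encodeInput f) {S : Schema} {R : Fin S.sig.num}
    (T₁ : List (Template (S.sig.arity R)))
    (T₂ T₃ : List (Template (S.sig.arity R) × Template (S.sig.arity R))) (F : α → Input S)
    (hfacts : ∀ x, (F x).facts = (f x).facts.flatMap fun φ => T₁.map fun τ => τ.fact φ)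
    (hpairs : ∀ x, (F x).pairs =
      ((f x).facts.flatMap fun φ => T₂.map fun t => (t.1.fact φ, t.2.fact φ)) ++
        (f x).pairs.flatMap fun p => T₃.map fun t => (t.1.fact p.1, t.2.fact p.2)) :
    PolyTime ea encodeInput F := by
  refine hf.markedInput.postProc (filler T₁ T₂ T₃) (fun x => fillerBlocks (f x))
    (fun x => annotate_filler_markedInput (f x)) (fun x => isBlock_of_mem_fillerBlocks (f x)) ?_
  intro x
  have hm := flatMap_passes_marker (T₁ := T₁) (T₂ := T₂) (T₃ := T₃)
  rw [encodeInput, hfacts, hpairs, fillerBlocks]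
  simp only [List.flatMap_singleton] at hm
  simp only [List.flatMap_append, List.flatMap_map, flatMap_passes_segment_zero,
    flatMap_passes_segment_one, flatMap_passes_segment_two, hm, List.flatMap_singleton,
    List.flatMap_assoc]

end CleanDB

namespace CleanDB

/-! ### Optimal repairs with respect to a conflict relation -/

section Abstract

variable {α : Type*}

/-- `J` contains no conflict. -/
def Indep (conf : α → α → Prop) (J : Finset α) : Prop :=
  ∀ f ∈ J, ∀ g ∈ J, ¬ conf f g

/-- Every element of `J'` that is not in `J ≠ J'` is dominated by an element of `J` not in `J'`. -/
def Improves (prec : α → α → Prop) (J J' : Finset α) : Prop :=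
  J ≠ J' ∧ ∀ f' ∈ J', f' ∉ J → ∃ f ∈ J, f ∉ J' ∧ prec f f'

/-- `J` is an independent subset of `I` without independent improvement. -/
def Optimal (I : Finset α) (conf prec : α → α → Prop) (J : Finset α) : Prop :=
  J ⊆ I ∧ Indep conf J ∧ ∀ K ⊆ I, Indep conf K → ¬ Improves prec K J

theorem Optimal.image_iff {β : Type*} [DecidableEq β] {I : Finset α}
    {conf prec : α → α → Prop} {conf' prec' : β → β → Prop} {ψ : α → β}
    (hψ : Function.Injective ψ) (hconf : ∀ x ∈ I, ∀ y ∈ I, conf' (ψ x) (ψ y) ↔ conf x y)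
    (hprec : ∀ x ∈ I, ∀ y ∈ I, prec' (ψ x) (ψ y) ↔ prec x y) {J : Finset α} (hJ : J ⊆ I) :
    Optimal (I.image ψ) conf' prec' (J.image ψ) ↔ Optimal I conf prec J := by
  have hind : ∀ K ⊆ I, Indep conf' (K.image ψ) ↔ Indep conf K := by
    intro K hK
    simp only [Indep, Finset.forall_mem_image]
    exact forall₂_congr fun x hx => forall₂_congr fun y hy => not_congr (hconf x (hK hx) y (hK hy))
  have himp : ∀ K ⊆ I, Improves prec' (K.image ψ) (J.image ψ) ↔ Improves prec K J := by
    intro K hK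
    refine and_congr (Finset.image_injective hψ).ne_iff ?_
    simp only [Finset.forall_mem_image, Finset.exists_mem_image, hψ.mem_finset_image]
    refine forall₂_congr fun x hx => imp_congr_right fun _ => exists_congr fun y => ?_
    exact and_congr_right fun hy => and_congr_right fun _ => hprec y (hK hy) x (hJ hx)
  unfold Optimal
  refine and_congr (by simp [hJ, Finset.image_subset_image hJ]) (and_congr (hind J hJ) ?_)
  constructor
  · intro h K hK hKi hKJ
    exact h _ (Finset.image_subset_image hK) ((hind K hK).2 hKi) ((himp K hK).2 hKJ)
  · intro h K hK hKi hKJ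
    obtain ⟨K, hK', rfl⟩ := Finset.subset_image_iff.1 hK
    exact h K hK' ((hind K hK').1 hKi) ((himp K hK').1 hKJ)

theorem existsUnique_optimal_image_iff {β : Type*} [DecidableEq β] {I : Finset α}
    {conf prec : α → α → Prop} {conf' prec' : β → β → Prop} {ψ : α → β}
    (hψ : Function.Injective ψ) (hconf : ∀ x ∈ I, ∀ y ∈ I, conf' (ψ x) (ψ y) ↔ conf x y)
    (hprec : ∀ x ∈ I, ∀ y ∈ I, prec' (ψ x) (ψ y) ↔ prec x y) :
    (∃! J, Optimal (I.image ψ) conf' prec' J) ↔ ∃! J, Optimal I conf prec J := by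
  constructor
  · rintro ⟨J, hJ, hu⟩
    obtain ⟨J, hJI, rfl⟩ := Finset.subset_image_iff.1 hJ.1
    refine ⟨J, (Optimal.image_iff hψ hconf hprec hJI).1 hJ, fun K hK => ?_⟩
    exact Finset.image_injective hψ (hu _ ((Optimal.image_iff hψ hconf hprec hK.1).2 hK))
  · rintro ⟨J, hJ, hu⟩
    refine ⟨J.image ψ, (Optimal.image_iff hψ hconf hprec hJ.1).2 hJ, fun K hK => ?_⟩
    obtain ⟨K, hKI, rfl⟩ := Finset.subset_image_iff.1 hK.1
    rw [hu K ((Optimal.image_iff hψ hconf hprec hKI).1 hK)]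

end Abstract

/-- Two facts violate a functional dependency of the schema. -/
def Conflict (S : Schema) (f g : Fact S.sig) : Prop :=
  ∃ d ∈ S.deps, ¬ d.SatisfiedBy {f, g}

theorem Conflict.symm {S : Schema} {f g : Fact S.sig} (h : Conflict S f g) : Conflict S g f := by
  rwa [Conflict, Finset.pair_comm]

theorem isConsistentSub_iff {S : Schema} {I J : Instance S.sig} :
    IsConsistentSub I (conflictGraph S I) J ↔ J ⊆ I ∧ Indep (Conflict S) J := by
  refine and_congr_right fun hJ => ⟨fun h f hf g hg hfg => ?_, ?_⟩
  · exact h {f, g} ⟨f, hJ hf, g, hJ hg, rfl, hfg⟩ (by simp [Finset.insert_subset_iff, hf, hg])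
  · rintro h e ⟨f, -, g, -, rfl, hfg⟩ he
    exact h f (he (by simp)) g (he (by simp)) hfg

theorem isGRepair_iff {S : Schema} {I J : Instance S.sig}
    {prec : Fact S.sig → Fact S.sig → Prop} :
    IsGRepair I (conflictGraph S I) prec J ↔ Optimal I (Conflict S) prec J := by
  unfold IsGRepair IsGlobalImprovement Optimal Improves
  simp only [isConsistentSub_iff, Finset.mem_sdiff]
  constructor
  · rintro ⟨⟨h₁, h₂⟩, h₃⟩
    refine ⟨h₁, h₂, fun K hK hKi hKJ => h₃ ⟨K, ⟨hK, hKi⟩, ⟨h₁, h₂⟩, hKJ.1, ?_⟩⟩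
    rintro f ⟨hf, hf'⟩
    obtain ⟨g, hg, hg', hgf⟩ := hKJ.2 f hf hf'
    exact ⟨g, ⟨hg, hg'⟩, hgf⟩
  · rintro ⟨h₁, h₂, h₃⟩
    refine ⟨⟨h₁, h₂⟩, ?_⟩
    rintro ⟨K, ⟨hK, hKi⟩, -, hne, hKJ⟩
    refine h₃ K hK hKi ⟨hne, fun f hf hf' => ?_⟩
    obtain ⟨g, ⟨hg, hg'⟩, hgf⟩ := hKJ f ⟨hf, hf'⟩
    exact ⟨g, hg, hg', hgf⟩

theorem mem_gCategoricity_iff {S : Schema} {D : Input S} :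
    D ∈ GCategoricity S ↔
      ∃! J, Optimal D.facts.toFinset (Conflict S) (fun f g => (f, g) ∈ D.pairs) J :=
  existsUnique_congr fun _ => isGRepair_iff

theorem neighbors_of_conflict {S : Schema} {I : Instance S.sig} {f g : Fact S.sig} (hf : f ∈ I)
    (hg : g ∈ I) (h : Conflict S f g) : Neighbors (conflictGraph S I) f g :=
  ⟨{f, g}, ⟨f, hf, g, hg, rfl, h⟩, by simp, by simp⟩

/-- Distinctness matters: a fact on an edge is its own neighbor by definition. For priorities it
follows from acyclicity. -/
theorem conflict_of_neighbors {S : Schema} {I : Instance S.sig} {f g : Fact S.sig} (hne : f ≠ g)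
    (h : Neighbors (conflictGraph S I) f g) : Conflict S f g := by
  obtain ⟨_, ⟨f', -, g', -, rfl, h⟩, hf, hg⟩ := h
  simp only [Finset.mem_insert, Finset.mem_singleton] at hf hg
  rcases hf with rfl | rfl <;> rcases hg with rfl | rfl
  · exact absurd rfl hne
  · exact h
  · exact Conflict.symm h
  · exact absurd rfl hne

theorem Input.conflict {S : Schema} (D : Input S) {f g : Fact S.sig} (h : (f, g) ∈ D.pairs) :
    Conflict S f g :=
  conflict_of_neighbors (fun hfg => D.valid.acyclic f (.single (by rwa [← hfg] at h)))
    (D.valid.neighbors f g h)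

theorem conflictGraph_subset {S : Schema} {I : Instance S.sig} :
    ∀ e ∈ conflictGraph S I, e ⊆ I := by
  rintro _ ⟨f, hf, g, hg, rfl, -⟩
  simp [Finset.insert_subset_iff, hf, hg]

/-! ### Sets of attributes that violate the dependencies -/

/-- Two facts over `R` that agree on the attributes in `Z` exactly violate a dependency. -/
def Violating (S : Schema) (R : Fin S.sig.num) (Z : Finset (Fin (S.sig.arity R))) : Prop :=
  ∃ X Y : Finset (Fin (S.sig.arity R)), (⟨R, X, Y⟩ : FD S.sig) ∈ S.deps ∧ X ⊆ Z ∧ ¬ Y ⊆ Z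

/-- The attributes on which two tuples agree. -/
def agreement {k : ℕ} (t u : Fin k → Const) : Finset (Fin k) :=
  Finset.univ.filter fun i => t i = u i

theorem agreement_comm {k : ℕ} (t u : Fin k → Const) : agreement t u = agreement u t := by
  simp [agreement, eq_comm]

theorem agreement_self {k : ℕ} (t : Fin k → Const) : agreement t t = Finset.univ := by
  simp [agreement]

theorem exists_agreement_eq {k : ℕ} (Z : Finset (Fin k)) :
    ∃ t u : Fin k → Const, agreement t u = Z :=
  ⟨fun _ => [], fun i => if i ∈ Z then [] else [true], by
    ext i; by_cases h : i ∈ Z <;> simp [agreement, h]⟩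

theorem not_violating_univ (S : Schema) (R : Fin S.sig.num) : ¬ Violating S R Finset.univ :=
  fun ⟨_, Y, _, _, h⟩ => h (Finset.subset_univ Y)

/-- Non-violating sets are the attribute sets closed under the dependencies. -/
theorem not_violating_inter {S : Schema} {R : Fin S.sig.num} {P Q : Finset (Fin (S.sig.arity R))}
    (hP : ¬ Violating S R P) (hQ : ¬ Violating S R Q) : ¬ Violating S R (P ∩ Q) := by
  rintro ⟨X, Y, hd, hX, hY⟩
  have h₁ : Y ⊆ P := by_contra fun h => hP ⟨X, Y, hd, hX.trans Finset.inter_subset_left, h⟩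
  have h₂ : Y ⊆ Q := by_contra fun h => hQ ⟨X, Y, hd, hX.trans Finset.inter_subset_right, h⟩
  exact hY (Finset.subset_inter h₁ h₂)

theorem satisfiedBy_iff {σ : Signature} {R : Fin σ.num} {X Y : Finset (Fin (σ.arity R))}
    {I : Instance σ} : (⟨R, X, Y⟩ : FD σ).SatisfiedBy I ↔
      ∀ t u : Fin (σ.arity R) → Const, (⟨R, t⟩ : Fact σ) ∈ I → (⟨R, u⟩ : Fact σ) ∈ I →
        ¬ (X ⊆ agreement t u ∧ ¬ Y ⊆ agreement t u) := by
  simp only [FD.SatisfiedBy, agreement, Finset.subset_iff, Finset.mem_filter, Finset.mem_univ,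
    true_and, not_and, not_not]

theorem satisfies_depsOn_iff {S : Schema} {R : Fin S.sig.num} {I : Instance S.sig} :
    Satisfies I (S.depsOn R) ↔
      ∀ t u : Fin (S.sig.arity R) → Const, (⟨R, t⟩ : Fact S.sig) ∈ I →
        (⟨R, u⟩ : Fact S.sig) ∈ I → ¬ Violating S R (agreement t u) := by
  constructor
  · rintro h t u ht hu ⟨X, Y, hd, hXY⟩
    exact satisfiedBy_iff.1 (h ⟨R, X, Y⟩ ⟨hd, rfl⟩) t u ht hu hXY
  · rintro h ⟨_, X, Y⟩ ⟨hd, rfl⟩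
    exact satisfiedBy_iff.2 fun t u ht hu hXY => h t u ht hu ⟨X, Y, hd, hXY⟩

/-- Satisfaction is a condition on pairs of facts that sees only their agreement set, and each set
is the agreement set of some two-fact instance. -/
theorem equivalent_singleton_iff {S : Schema} {R : Fin S.sig.num}
    {X Y : Finset (Fin (S.sig.arity R))} :
    Equivalent (S.depsOn R) {(⟨R, X, Y⟩ : FD S.sig)} ↔
      ∀ Z, Violating S R Z ↔ X ⊆ Z ∧ ¬ Y ⊆ Z := by
  have hsing : ∀ I, Satisfies I {(⟨R, X, Y⟩ : FD S.sig)} ↔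
      (⟨R, X, Y⟩ : FD S.sig).SatisfiedBy I := fun I => by simp [Satisfies]
  constructor
  · intro h Z
    obtain ⟨t, u, rfl⟩ := exists_agreement_eq Z
    have hI := h {⟨R, t⟩, ⟨R, u⟩}
    rw [hsing, satisfies_depsOn_iff, satisfiedBy_iff] at hI
    have key : ∀ p : Finset (Fin (S.sig.arity R)) → Prop, ¬ p Finset.univ →
        ((∀ t' u' : Fin (S.sig.arity R) → Const,
          (⟨R, t'⟩ : Fact S.sig) ∈ ({⟨R, t⟩, ⟨R, u⟩} : Instance S.sig) →
          (⟨R, u'⟩ : Fact S.sig) ∈ ({⟨R, t⟩, ⟨R, u⟩} : Instance S.sig) →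
          ¬ p (agreement t' u')) ↔ ¬ p (agreement t u)) := by
      intro p hp
      constructor
      · intro h'; exact h' t u (by simp) (by simp)
      · intro h' t' u' ht hu
        simp only [Finset.mem_insert, Finset.mem_singleton, Sigma.mk.injEq, heq_eq_eq,
          true_and] at ht hu
        rcases ht with rfl | rfl <;> rcases hu with rfl | rfl
        · rwa [agreement_self]
        · exact h'
        · rwa [agreement_comm]
        · rwa [agreement_self]
    rw [key _ (not_violating_univ S R),
      key (fun Z => X ⊆ Z ∧ ¬ Y ⊆ Z) (fun h => h.2 (Finset.subset_univ _))] at hI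
    exact not_iff_not.1 hI
  · intro h I
    rw [hsing, satisfies_depsOn_iff, satisfiedBy_iff]
    simp only [h]

theorem conflict_iff {S : Schema} {R : Fin S.sig.num} {t u : Fin (S.sig.arity R) → Const} :
    Conflict S ⟨R, t⟩ ⟨R, u⟩ ↔ Violating S R (agreement t u) := by
  constructor
  · rintro ⟨⟨R', X, Y⟩, hd, h⟩
    simp only [satisfiedBy_iff, Finset.mem_insert, Finset.mem_singleton, not_forall, not_not] at h
    obtain ⟨t', u', ht, hu, hXY⟩ := h
    obtain rfl : R' = R := by
      rcases ht with ht | ht <;> exact congrArg Sigma.fst ht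
    simp only [Sigma.mk.injEq, heq_eq_eq, true_and] at ht hu
    rcases ht with rfl | rfl <;> rcases hu with rfl | rfl
    · exact absurd (by rw [agreement_self]; exact Finset.subset_univ Y) hXY.2
    · exact ⟨X, Y, hd, hXY⟩
    · exact ⟨X, Y, hd, by rwa [agreement_comm]⟩
    · exact absurd (by rw [agreement_self]; exact Finset.subset_univ Y) hXY.2
  · rintro ⟨X, Y, hd, hXY⟩
    refine ⟨⟨R, X, Y⟩, hd, fun h => ?_⟩
    exact satisfiedBy_iff.1 h t u (by simp) (by simp) hXY

/-- If the dependencies over `R` are not equivalent to a single one, then there are two violating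
sets with non-violating intersection, or there is a chain of two dependencies. -/
theorem exists_of_not_single {S : Schema} {R : Fin S.sig.num}
    (h : ∀ d : FD S.sig, d.rel = R → ¬ Equivalent (S.depsOn R) {d}) :
    (∃ P Q, Violating S R P ∧ Violating S R Q ∧ ¬ Violating S R (P ∩ Q)) ∨
      ∃ X₀ Y₀ X₁, X₀ ⊆ Y₀ ∧ Y₀ ⊆ X₁ ∧ Violating S R X₀ ∧
        (∀ Z, X₀ ⊆ Z → ¬ Y₀ ⊆ Z → Violating S R Z) ∧ ¬ Violating S R Y₀ ∧ Violating S R X₁ := by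
  by_contra! hcon
  obtain ⟨hA, hB⟩ := hcon
  by_cases hex : ∃ Z, Violating S R Z
  -- Without the first alternative, violating sets are stable under intersection, so a minimal one
  -- is the least one.
  · obtain ⟨X₀, hX₀⟩ := (Set.toFinite {Z | Violating S R Z}).exists_minimal hex
    -- `Y₀` is the closure of `X₀`: non-violating sets are stable under intersection, so minimal
    -- again means least.
    obtain ⟨Y₀, hY₀⟩ := (Set.toFinite {Z | X₀ ⊆ Z ∧ ¬ Violating S R Z}).exists_minimal
      ⟨Finset.univ, Finset.subset_univ _, not_violating_univ S R⟩
    have hX : ∀ Z, Violating S R Z → X₀ ⊆ Z := fun Z hZ =>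
      (hX₀.le_of_le (hA X₀ Z hX₀.prop hZ) Finset.inter_subset_left).trans Finset.inter_subset_right
    have hY : ∀ Z, X₀ ⊆ Z → ¬ Y₀ ⊆ Z → Violating S R Z := fun Z hZ hYZ => by
      by_contra hv
      exact hYZ ((hY₀.le_of_le ⟨Finset.subset_inter hY₀.prop.1 hZ,
        not_violating_inter hY₀.prop.2 hv⟩ Finset.inter_subset_left).trans
          Finset.inter_subset_right)
    refine h ⟨R, X₀, Y₀⟩ rfl (equivalent_singleton_iff.2 fun Z => ⟨fun hZ => ⟨hX Z hZ, fun hYZ => ?_⟩,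
      fun hZ => hY Z hZ.1 hZ.2⟩)
    exact hB X₀ Y₀ Z hY₀.prop.1 hYZ hX₀.prop hY hY₀.prop.2 hZ
  -- With no violating set at all, the trivial dependency ∅ → ∅ is equivalent.
  · push Not at hex
    exact h ⟨R, ∅, ∅⟩ rfl (equivalent_singleton_iff.2 fun Z => by simp [hex])

theorem violating_schemaZero {Z : Finset (Fin 2)} :
    Violating schemaZero (0 : Fin 1) Z ↔ (0 ∈ Z ∧ 1 ∉ Z) ∨ (1 ∈ Z ∧ 0 ∉ Z) := by
  constructor
  · rintro ⟨X, Y, hd, hX, hY⟩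
    rcases hd with hd | hd
    · cases hd
      left; simpa using And.intro hX hY
    · cases hd
      right; simpa using And.intro hX hY
  · rintro (⟨h₀, h₁⟩ | ⟨h₁, h₀⟩)
    · exact ⟨{(0 : Fin 2)}, {(1 : Fin 2)}, Or.inl rfl, by simpa using h₀, by simpa using h₁⟩
    · exact ⟨{(1 : Fin 2)}, {(0 : Fin 2)}, Or.inr rfl, by simpa using h₁, by simpa using h₀⟩

/-- `{0}` and `{1}` are violating and ∅ is not. A single X → Y would need X ⊆ {0} ∩ {1} = ∅, so Y ⊆
∅ since ∅ is not violating, and then nothing is violating. -/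
theorem not_singleFDPerRelation_schemaZero : ¬ schemaZero.SingleFDPerRelation := by
  intro h
  obtain ⟨⟨R, X, Y⟩, hR, h⟩ := h (0 : Fin 1)
  dsimp only at hR
  subst hR
  rw [equivalent_singleton_iff] at h
  have h' : ∀ Z : Finset (Fin 2), ((0 ∈ Z ∧ 1 ∉ Z) ∨ (1 ∈ Z ∧ 0 ∉ Z)) ↔
      (X : Finset (Fin 2)) ⊆ Z ∧ ¬ (Y : Finset (Fin 2)) ⊆ Z :=
    fun Z => violating_schemaZero.symm.trans (h Z)
  have h₀ := (h' {0}).1 (by decide)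
  have h₁ := (h' {1}).1 (by decide)
  have hX : (X : Finset (Fin 2)) ⊆ ∅ := by
    rw [show (∅ : Finset (Fin 2)) = {0} ∩ {1} by decide]
    exact Finset.subset_inter h₀.1 h₁.1
  have hY : (Y : Finset (Fin 2)) ⊆ ∅ := by
    by_contra hY
    exact absurd ((h' ∅).2 ⟨hX, hY⟩) (by decide)
  exact h₀.2 (hY.trans (Finset.empty_subset _))

theorem fact_sigZero_ext {f g : Fact sigZero} (ha : constA f = constA g)
    (hb : constB f = constB g) : f = g := by
  obtain ⟨R, t⟩ := f
  obtain ⟨R', u⟩ := g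
  obtain rfl : R = R' := Subsingleton.elim (α := Fin 1) R R'
  congr 1
  funext i
  change Fin 2 at i
  fin_cases i
  · exact ha
  · exact hb

theorem conflict_schemaZero_iff {f g : Fact sigZero} :
    Conflict schemaZero f g ↔ f ≠ g ∧ (constA f = constA g ∨ constB f = constB g) := by
  obtain ⟨R, t⟩ := f
  obtain ⟨R', u⟩ := g
  obtain rfl : R = (0 : Fin 1) := Subsingleton.elim (α := Fin 1) R 0
  obtain rfl : R' = (0 : Fin 1) := Subsingleton.elim (α := Fin 1) R' 0
  rw [conflict_iff, violating_schemaZero]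
  have h₀ : (0 : Fin 2) ∈ agreement t u ↔ t (0 : Fin 2) = u (0 : Fin 2) := by simp [agreement]
  have h₁ : (1 : Fin 2) ∈ agreement t u ↔ t (1 : Fin 2) = u (1 : Fin 2) := by simp [agreement]
  have hne : (⟨(0 : Fin 1), t⟩ : Fact sigZero) ≠ ⟨(0 : Fin 1), u⟩ ↔
      ¬ (t (0 : Fin 2) = u (0 : Fin 2) ∧ t (1 : Fin 2) = u (1 : Fin 2)) :=
    not_congr ⟨fun h => by cases h; exact ⟨rfl, rfl⟩, fun h => fact_sigZero_ext h.1 h.2⟩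
  rw [hne]
  refine (or_congr (and_congr h₀ (not_congr h₁)) (and_congr h₁ (not_congr h₀))).trans ?_
  simp only [constA, constB]
  tauto

end CleanDB

namespace CleanDB

/-! ### Existence of optimal repairs -/

theorem exists_undominated {α : Type*} {prec : α → α → Prop}
    (hac : ∀ f, ¬ Relation.TransGen prec f f) (I : Finset α) (hI : I.Nonempty) :
    ∃ m ∈ I, ∀ x ∈ I, ¬ prec x m := by
  let r : I → I → Prop := fun x y => Relation.TransGen prec x y
  have : IsTrans I r := ⟨fun _ _ _ h h' => h.trans h'⟩
  have : Std.Irrefl r := ⟨fun x => hac x⟩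
  have hwf : WellFounded r := Finite.wellFounded_of_trans_of_irrefl r
  obtain ⟨x, hx⟩ := hI
  obtain ⟨m, -, hm⟩ := hwf.has_min Set.univ ⟨⟨x, hx⟩, trivial⟩
  exact ⟨m, m.2, fun y hy h => hm ⟨y, hy⟩ trivial (.single h)⟩

theorem existsUnique_optimal_empty {α : Type*} {conf prec : α → α → Prop} :
    ∃! J, Optimal ∅ conf prec J :=
  ⟨∅, ⟨subset_rfl, by simp [Indep], fun _ hK _ hi => hi.1 (Finset.subset_empty.1 hK)⟩,
    fun _ hJ => Finset.subset_empty.1 hJ.1⟩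

/-- Greedy construction: take an undominated element, discard everything in conflict with it, and
recurse. -/
theorem exists_optimal {α : Type*} {conf prec : α → α → Prop} (hirr : ∀ f, ¬ conf f f)
    (hac : ∀ f, ¬ Relation.TransGen prec f f) (I : Finset α) : ∃ J, Optimal I conf prec J := by
  classical
  induction I using Finset.strongInduction with
  | H I ih =>
    rcases I.eq_empty_or_nonempty with rfl | hI
    · exact existsUnique_optimal_empty.exists
    obtain ⟨m, hm, hmax⟩ := exists_undominated hac I hI
    let I' := I.filter fun x => x ≠ m ∧ ¬ conf m x ∧ ¬ conf x m
    obtain ⟨J, hJ, hJi, hJo⟩ := ih I' (Finset.filter_ssubset.2 ⟨m, hm, by simp⟩)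
    have hJ' : ∀ x ∈ J, x ∈ I ∧ x ≠ m ∧ ¬ conf m x ∧ ¬ conf x m := fun x hx => by
      simpa [I'] using hJ hx
    refine ⟨insert m J, ?_, ?_, ?_⟩
    · exact Finset.insert_subset hm fun x hx => (hJ' x hx).1
    · intro f hf g hg
      rcases Finset.mem_insert.1 hf with rfl | hf' <;> rcases Finset.mem_insert.1 hg with rfl | hg'
      · exact hirr _
      · exact (hJ' g hg').2.2.1
      · exact (hJ' f hf').2.2.2
      · exact hJi f hf' g hg'
    · rintro K hK hKi ⟨hne, himp⟩
      have hmK : m ∈ K := by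
        by_contra hmK
        obtain ⟨f, hf, -, hfm⟩ := himp m (by simp) hmK
        exact hmax f (hK hf) hfm
      -- An improvement must retain the undominated `m`, so removing `m` from it gives an
      -- improvement of `J` among the remaining elements.
      refine hJo (K.erase m) (fun x hx => ?_) (fun f hf g hg => ?_) ⟨fun h => hne ?_, ?_⟩
      · rw [Finset.mem_erase] at hx
        exact Finset.mem_filter.2 ⟨hK hx.2, hx.1, hKi m hmK x hx.2, hKi x hx.2 m hmK⟩
      · exact hKi f (Finset.mem_of_mem_erase hf) g (Finset.mem_of_mem_erase hg)
      · rw [← h, Finset.insert_erase hmK]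
      · intro f hf hfK
        have hfm := (hJ' f hf).2.1
        obtain ⟨g, hg, hgJ, hgf⟩ := himp f (by simp [hf]) fun h => hfK (by simp [hfm, h])
        simp only [Finset.mem_insert, not_or] at hgJ
        exact ⟨g, by simp [hgJ.1, hg], hgJ.2, hgf⟩

/-- A proper consistent superset is an improvement vacuously. This lets the gadget test
non-containment in place of distinctness. -/
theorem Optimal.not_subset {α : Type*} {I J J' : Finset α} {conf prec : α → α → Prop}
    (hJ : Optimal I conf prec J) (hJ' : Optimal I conf prec J') (hne : J ≠ J') : ¬ J ⊆ J' :=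
  fun h => hJ.2.2 J' hJ'.1 hJ'.2.1 ⟨hne.symm, fun _ hf hf' => absurd (h hf) hf'⟩

/-! ### The gadget -/

/-- The ways in which a pair of candidates can be refuted: a candidate has an improvement, a
candidate is inconsistent, or the first candidate is contained in the second one. -/
inductive Mode
  | imp (c : Bool)
  | err (c : Bool)
  | sub
  deriving DecidableEq, Fintype

/-- The roles of a fact in a refutation. -/
inductive Role
  | inn (c : Bool)
  | str (c : Bool)
  | out (c : Bool)
  | skip (c : Bool)
  | errA (c : Bool)
  | errB (c : Bool)
  | both
  | low
  deriving DecidableEq, Fintype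

/-- The mode to which a role belongs. -/
def Role.mode : Role → Mode
  | .inn c => .imp c
  | .str c => .imp c
  | .out c => .imp c
  | .skip c => .err c
  | .errA c => .err c
  | .errB c => .err c
  | .both => .sub
  | .low => .sub

/-- The kinds of nodes of the gadget. -/
inductive Kind
  | pos (c : Bool)
  | neg (c : Bool)
  | row (c : Bool)
  | col (c : Bool)
  | goal
  | keyA
  | keyB
  | gate (μ : Mode)
  | mode (μ : Mode)
  | role (v : Role)
  | rowSel
  | colSel
  | top
  deriving DecidableEq, Fintype

/-- The block of a kind: candidates, refutations, and the node above all refutations. -/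
def Kind.block : Kind → ℕ
  | .mode _ => 1
  | .role _ => 1
  | .rowSel => 1
  | .colSel => 1
  | .top => 2
  | _ => 0

/-- The group of a kind, and the constants of a fact on which it depends. -/
def Kind.group : Kind → ℕ × Bool × Bool
  | .pos c => (c.toNat, true, true)
  | .neg c => (c.toNat, true, true)
  | .row c => (2 + c.toNat, true, false)
  | .col c => (4 + c.toNat, false, true)
  | .goal => (6, false, false)
  | .keyA => (7, true, true)
  | .keyB => (8, true, true)
  | .gate (.imp c) => (9 + c.toNat, true, true)
  | .gate (.err c) => (11 + c.toNat, true, true)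
  | .gate .sub => (13, true, true)
  | .mode _ => (14, false, false)
  | .role _ => (15, true, true)
  | .rowSel => (16, true, false)
  | .colSel => (17, false, true)
  | .top => (18, false, false)

/-- Whether a node of the kind depends on the fact. -/
def Kind.usesFact : Kind → Bool
  | .goal => false
  | .mode _ => false
  | .top => false
  | _ => true

/-- The kinds to which a mode is preferred. -/
def Mode.beats : Mode → Kind → Bool
  | .imp c, .pos c' => c' != c
  | .imp c, .neg c' => c' != c
  | .imp _, .row _ => true
  | .imp _, .col _ => true
  | .err c, .pos c' => c' != c
  | .err c, .neg c' => c' != c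
  | .err c, .row c' => c' != c
  | .err c, .col c' => c' != c
  | .sub, .row _ => true
  | .sub, .col _ => true
  | .sub, .goal => true
  | μ, .gate μ' => μ' != μ
  | _, _ => false

/-- The kinds to which a role is preferred. -/
def Role.beats : Role → Kind → Bool
  | .inn c, .pos c' => c' == c
  | .inn c, .neg c' => c' == c
  | .str c, .neg c' => c' == c
  | .str _, .goal => true
  | .out c, .neg c' => c' == c
  | .out _, .keyA => true
  | .out _, .keyB => true
  | .skip c, .pos c' => c' == c
  | .skip c, .neg c' => c' == c
  | .skip c, .row c' => c' == c
  | .skip c, .col c' => c' == c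
  | .skip _, .keyA => true
  | .skip _, .keyB => true
  | .errA c, .pos c' => c' == c
  | .errA c, .col c' => c' == c
  | .errA _, .goal => true
  | .errA _, .keyA => true
  | .errA _, .keyB => true
  | .errB c, .pos c' => c' == c
  | .errB c, .row c' => c' == c
  | .errB _, .goal => true
  | .errB _, .keyA => true
  | .errB _, .keyB => true
  | .both, .pos _ => true
  | .both, .neg c' => !c'
  | .both, .keyA => true
  | .both, .keyB => true
  | .low, .pos c' => c'
  | .low, .neg _ => true
  | .low, .keyA => true
  | .low, .keyB => true
  | v, .gate μ => μ == v.mode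
  | _, _ => false

/-- The preferences between nodes of the same fact. -/
def Kind.beats : Kind → Kind → Bool
  | .top, κ => κ.block == 1
  | .mode μ, κ => μ.beats κ
  | .role v, κ => v.beats κ
  | .rowSel, .keyA => true
  | .colSel, .keyB => true
  | _, _ => false

/-- The preferences between nodes of two facts, the first of which has priority. -/
def Kind.lifts : Kind → Kind → Bool
  | .role (.inn c), .pos c' => c' == c
  | .role (.str c), .pos c' => c' == c
  | _, _ => false

theorem Kind.block_le (κ : Kind) : κ.block ≤ 2 := by cases κ <;> simp [Kind.block]

theorem Mode.block_of_beats {μ : Mode} {κ : Kind} (h : μ.beats κ = true) : κ.block = 0 := by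
  cases μ <;> cases κ <;> first | rfl | simp [Mode.beats] at h

theorem Role.block_of_beats {v : Role} {κ : Kind} (h : v.beats κ = true) : κ.block = 0 := by
  cases v <;> cases κ <;> first | rfl | simp [Role.beats] at h

/-- Preferences descend by exactly one block. This yields acyclicity, and also makes each preference
a conflict, since distinct blocks conflict. -/
theorem Kind.block_of_beats {κ κ' : Kind} (h : κ.beats κ' = true) : κ.block = κ'.block + 1 := by
  cases κ with
  | top => simp only [Kind.beats, beq_iff_eq] at h; rw [h]; rfl
  | mode μ => rw [Mode.block_of_beats h]; rfl
  | role v => rw [Role.block_of_beats h]; rfl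
  | _ => cases κ' <;> first | rfl | simp [Kind.beats] at h

theorem Kind.lifts_iff {κ κ' : Kind} : κ.lifts κ' = true ↔
    ∃ c, (κ = .role (.inn c) ∨ κ = .role (.str c)) ∧ κ' = .pos c := by
  constructor
  · intro h
    cases κ with
    | role v => cases v <;> cases κ' <;> simp_all [Kind.lifts]
    | _ => simp [Kind.lifts] at h
  · rintro ⟨c, rfl | rfl, rfl⟩ <;> simp [Kind.lifts]

/-- Two nodes belong to the same group. -/
def SameGroup (κ : Kind) (f : Fact sigZero) (κ' : Kind) (f' : Fact sigZero) : Prop :=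
  κ.group = κ'.group ∧ (κ.group.2.1 = true → constA f = constA f') ∧
    (κ.group.2.2 = true → constB f = constB f')

/-- The nodes `mk κ f`, their conflicts and their priorities form the gadget for the facts `F` with
priority `prec₀`. -/
structure IsGadget {α : Type*} (F : Finset (Fact sigZero))
    (prec₀ : Fact sigZero → Fact sigZero → Prop) (mk : Kind → Fact sigZero → α) (I : Finset α)
    (conf prec : α → α → Prop) : Prop where
  prec_conflict : ∀ f g, prec₀ f g → Conflict schemaZero f g
  prec_mem : ∀ f g, prec₀ f g → f ∈ F ∧ g ∈ F
  acyclic : ∀ f, ¬ Relation.TransGen prec₀ f f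
  mk_eq_iff : ∀ κ f κ' f', mk κ f = mk κ' f' ↔ κ = κ' ∧ (κ.usesFact = true → f = f')
  mem_iff : ∀ x, x ∈ I ↔ ∃ κ, ∃ f ∈ F, x = mk κ f
  conf_iff : ∀ κ f κ' f', conf (mk κ f) (mk κ' f') ↔
    κ.block ≠ κ'.block ∨ (SameGroup κ f κ' f' ∧ mk κ f ≠ mk κ' f')
  prec_iff : ∀ x y, prec x y ↔
    (∃ κ κ', ∃ f ∈ F, κ.beats κ' = true ∧ x = mk κ f ∧ y = mk κ' f) ∨
      ∃ κ κ' f g, κ.lifts κ' = true ∧ prec₀ f g ∧ x = mk κ f ∧ y = mk κ' g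

/-! ### Uniqueness of the optimal repair as a refutation game between blocks -/

namespace IsGadget

variable {α : Type*} {F : Finset (Fact sigZero)} {prec₀ : Fact sigZero → Fact sigZero → Prop}
  {mk : Kind → Fact sigZero → α} {I : Finset α} {conf prec : α → α → Prop}

/-- All elements of `J` belong to the block `n`. -/
def InBlock (mk : Kind → Fact sigZero → α) (J : Finset α) (n : ℕ) : Prop :=
  ∀ κ f, mk κ f ∈ J → κ.block = n

/-- A set of candidates is refuted. -/
def Refuted (mk : Kind → Fact sigZero → α) (I : Finset α) (conf prec : α → α → Prop)
    (J : Finset α) : Prop :=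
  ∃ K ⊆ I, Indep conf K ∧ InBlock mk K 1 ∧ ∀ x ∈ J, ∃ y ∈ K, prec y x

theorem inBlock_of_mem (h : IsGadget F prec₀ mk I conf prec) {J : Finset α} (hJ : Indep conf J)
    {κ : Kind} {f : Fact sigZero} (hf : mk κ f ∈ J) : InBlock mk J κ.block := by
  intro κ' f' hf'
  by_contra hne
  exact hJ _ hf' _ hf ((h.conf_iff _ _ _ _).2 (Or.inl hne))

theorem block_of_prec (h : IsGadget F prec₀ mk I conf prec) {κ κ' : Kind} {f f' : Fact sigZero}
    (hp : prec (mk κ f) (mk κ' f')) : κ.block = κ'.block + 1 := by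
  rcases (h.prec_iff _ _).1 hp with ⟨κ₁, κ₂, g, -, hb, h₁, h₂⟩ | ⟨κ₁, κ₂, g, g', hl, -, h₁, h₂⟩
  · rw [((h.mk_eq_iff _ _ _ _).1 h₁).1, ((h.mk_eq_iff _ _ _ _).1 h₂).1]
    exact Kind.block_of_beats hb
  · rw [((h.mk_eq_iff _ _ _ _).1 h₁).1, ((h.mk_eq_iff _ _ _ _).1 h₂).1]
    obtain ⟨c, rfl | rfl, rfl⟩ := Kind.lifts_iff.1 hl <;> rfl

theorem acyclic_prec (h : IsGadget F prec₀ mk I conf prec) (x : α) :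
    ¬ Relation.TransGen prec x x := by
  have key : ∀ x y, prec x y → ∃ κ f κ' f', x = mk κ f ∧ y = mk κ' f' := by
    intro x y hp
    rcases (h.prec_iff _ _).1 hp with ⟨κ₁, κ₂, g, -, -, rfl, rfl⟩ | ⟨κ₁, κ₂, g, g', -, -, rfl, rfl⟩ <;>
      exact ⟨_, _, _, _, rfl, rfl⟩
  have trans : ∀ y, Relation.TransGen prec x y →
      ∃ κ f κ' f', x = mk κ f ∧ y = mk κ' f' ∧ κ'.block < κ.block := by
    intro y hy
    induction hy with
    | single hp =>
      obtain ⟨κ, f, κ', f', rfl, rfl⟩ := key _ _ hp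
      exact ⟨κ, f, κ', f', rfl, rfl, by rw [h.block_of_prec hp]; omega⟩
    | tail _ hp ih =>
      obtain ⟨κ, f, κ', f', rfl, hz, hlt⟩ := ih
      obtain ⟨κ₁, f₁, κ₂, f₂, rfl, rfl⟩ := key _ _ hp
      refine ⟨κ, f, κ₂, f₂, rfl, rfl, ?_⟩
      have := h.block_of_prec hp
      rw [((h.mk_eq_iff _ _ _ _).1 hz).1] at this
      omega
  intro hx
  obtain ⟨κ, f, κ', f', rfl, heq, hlt⟩ := trans x hx
  rw [((h.mk_eq_iff _ _ _ _).1 heq).1] at hlt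
  exact lt_irrefl _ hlt

theorem eq_top_of_block {κ : Kind} (hκ : κ.block = 2) : κ = .top := by
  cases κ <;> first | rfl | simp [Kind.block] at hκ

theorem subset_top (h : IsGadget F prec₀ mk I conf prec) {f₀ : Fact sigZero} {J : Finset α}
    (hJI : J ⊆ I) (hJ : InBlock mk J 2) : J ⊆ {mk .top f₀} := by
  intro x hx
  obtain ⟨κ, f, -, rfl⟩ := (h.mem_iff x).1 (hJI hx)
  rw [Finset.mem_singleton, h.mk_eq_iff, eq_top_of_block (hJ κ f hx)]
  exact ⟨rfl, by simp [Kind.usesFact]⟩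

/-- Nothing is preferred to the top node, since no block lies above it, and it conflicts with every
other node. -/
theorem optimal_top (h : IsGadget F prec₀ mk I conf prec) {f₀ : Fact sigZero} (hf₀ : f₀ ∈ F) :
    Optimal I conf prec {mk .top f₀} := by
  refine ⟨?_, ?_, ?_⟩
  · rw [Finset.singleton_subset_iff, h.mem_iff]
    exact ⟨_, _, hf₀, rfl⟩
  · intro x hx y hy
    rw [Finset.mem_singleton] at hx hy
    subst hx hy
    rw [h.conf_iff]
    simp
  · rintro K hK hKi ⟨hne, himp⟩
    have ht : mk .top f₀ ∈ K := by
      by_contra ht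
      obtain ⟨x, hx, -, hp⟩ := himp _ (Finset.mem_singleton_self _) ht
      obtain ⟨κ, f, -, rfl⟩ := (h.mem_iff x).1 (hK hx)
      have := h.block_of_prec hp
      have := κ.block_le
      simp only [Kind.block] at *
      omega
    exact hne (subset_antisymm (h.subset_top hK (h.inBlock_of_mem hKi ht)) (by simpa using ht))

/-- By maximality an improvement drops some node of `J`; its dominator lies in block 1, and with it
the entire improvement. The improvement is then disjoint from `J` and dominates all of it, so it is
a refutation. -/
theorem optimal_of_not_refuted (h : IsGadget F prec₀ mk I conf prec) {J : Finset α} (hJI : J ⊆ I)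
    (hJi : Indep conf J) (hJ0 : InBlock mk J 0)
    (hr : ¬ Refuted mk I conf prec J) (hmax : ∀ K ⊆ I, Indep conf K → J ⊆ K → K = J) :
    Optimal I conf prec J := by
  refine ⟨hJI, hJi, ?_⟩
  rintro K hK hKi ⟨hKJ, himp⟩
  obtain ⟨x, hx, hxJ⟩ : ∃ x ∈ J, x ∉ K := by
    by_contra! hcon
    exact hKJ (hmax K hK hKi hcon)
  obtain ⟨y, hy, -, hyx⟩ := himp x hx hxJ
  obtain ⟨κ, f, -, rfl⟩ := (h.mem_iff x).1 (hJI hx)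
  obtain ⟨κ', f', -, rfl⟩ := (h.mem_iff y).1 (hK hy)
  have hb := h.block_of_prec hyx
  rw [hJ0 κ f hx] at hb
  have hK1 := h.inBlock_of_mem hKi hy
  rw [hb] at hK1
  refine hr ⟨K, hK, hKi, hK1, fun z hz => ?_⟩
  obtain ⟨κ'', f'', -, rfl⟩ := (h.mem_iff z).1 (hJI hz)
  obtain ⟨w, hw, -, hwz⟩ := himp _ hz fun hz' => by
    have h₁ := hK1 _ _ hz'
    rw [hJ0 _ _ hz] at h₁
    omega
  exact ⟨w, hw, hwz⟩

/-- The gadget has a unique optimal repair if and only if all sets of candidates are refuted. -/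
theorem existsUnique_iff (h : IsGadget F prec₀ mk I conf prec) (hF : F.Nonempty) :
    (∃! J, Optimal I conf prec J) ↔ ∀ J ⊆ I, Indep conf J → InBlock mk J 0 → J.Nonempty →
      Refuted mk I conf prec J := by
  obtain ⟨f₀, hf₀⟩ := hF
  have htop := h.optimal_top hf₀
  constructor
  · intro hu J hJI hJi hJ0 hne
    by_contra hr
    have hfin : {K | K ∈ I.powerset ∧ Indep conf K ∧ J ⊆ K}.Finite :=
      I.powerset.finite_toSet.subset fun K hK => hK.1
    -- Enlarging the set preserves being unrefuted, and a maximal consistent extension is optimal.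
    -- It is not the top node, against uniqueness.
    obtain ⟨J', hJJ', hJ'⟩ := hfin.exists_le_maximal
      ⟨Finset.mem_powerset.2 hJI, hJi, subset_rfl⟩
    obtain ⟨x, hx⟩ := hne
    obtain ⟨κ, f, -, rfl⟩ := (h.mem_iff x).1 (hJI hx)
    have hb := hJ0 κ f hx
    have hJ'0 := h.inBlock_of_mem hJ'.prop.2.1 (hJJ' hx)
    rw [hb] at hJ'0
    have hJ'I := Finset.mem_powerset.1 hJ'.prop.1
    have hopt : Optimal I conf prec J' := by
      refine h.optimal_of_not_refuted hJ'I hJ'.prop.2.1 hJ'0 ?_ ?_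
      · rintro ⟨K, hK, hKi, hK1, hKJ⟩
        exact hr ⟨K, hK, hKi, hK1, fun x hx => hKJ x (hJJ' hx)⟩
      · intro K hK hKi hJK
        exact (hJ'.eq_of_le ⟨Finset.mem_powerset.2 hK, hKi, hJJ'.trans hJK⟩ hJK).symm
    have htJ : mk .top f₀ ∈ J' := by
      rw [hu.unique hopt htop]; simp
    have := hJ'0 _ _ htJ
    simp [Kind.block] at this
  · intro hr
    refine ⟨_, htop, fun J hJ => ?_⟩
    -- The top node improves any consistent set inside block 1, including the empty set, so such a
    -- set cannot be optimal.
    have hcase : InBlock mk J 1 → J = {mk .top f₀} := by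
      intro hJ1
      exfalso
      refine hJ.2.2 _ htop.1 htop.2.1 ⟨?_, ?_⟩
      · rintro rfl
        simpa [Kind.block] using hJ1 .top f₀ (by simp)
      · intro x hx _
        obtain ⟨κ, f, hf, rfl⟩ := (h.mem_iff x).1 (hJ.1 hx)
        have hκ := hJ1 κ f hx
        refine ⟨_, Finset.mem_singleton_self _, fun ht => ?_, ?_⟩
        · simpa [Kind.block] using hJ1 .top f₀ ht
        · rw [h.prec_iff]
          refine Or.inl ⟨.top, κ, f, hf, by simp [Kind.beats, hκ], ?_, rfl⟩
          rw [h.mk_eq_iff]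
          exact ⟨rfl, by simp [Kind.usesFact]⟩
    rcases J.eq_empty_or_nonempty with rfl | ⟨x, hx⟩
    · exact hcase (by simp [InBlock])
    obtain ⟨κ, f, hf, rfl⟩ := (h.mem_iff x).1 (hJ.1 hx)
    have hblock := h.inBlock_of_mem hJ.2.1 hx
    have hle := κ.block_le
    obtain hκ | hκ | hκ : κ.block = 0 ∨ κ.block = 1 ∨ κ.block = 2 := by omega
    · rw [hκ] at hblock
      obtain ⟨K, hK, hKi, hK1, hKJ⟩ := hr J hJ.1 hJ.2.1 hblock ⟨_, hx⟩
      refine (hJ.2.2 K hK hKi ⟨?_, fun x hx _ => ?_⟩).elim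
      · rintro rfl
        have := hK1 _ _ hx
        omega
      · obtain ⟨y, hy, hyx⟩ := hKJ x hx
        refine ⟨y, hy, fun hyJ => ?_, hyx⟩
        obtain ⟨κ', f', -, rfl⟩ := (h.mem_iff y).1 (hK hy)
        have h₁ := hK1 _ _ hy
        have h₀ := hblock _ _ hyJ
        omega
    · exact hcase (hκ ▸ hblock)
    · refine subset_antisymm (h.subset_top hJ.1 (hκ ▸ hblock)) ?_
      rw [Finset.singleton_subset_iff]
      obtain rfl := eq_top_of_block hκ
      rwa [(h.mk_eq_iff .top f₀ .top f).2 ⟨rfl, by simp [Kind.usesFact]⟩]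

end IsGadget

end CleanDB

/-! ### From two optimal repairs to an unrefuted candidate set -/

namespace CleanDB

theorem Mode.not_beats_gate : ∀ μ : Mode, μ.beats (.gate μ) = false := by decide

theorem Role.mode_of_beats_gate :
    ∀ (v : Role) (μ : Mode), v.beats (.gate μ) = true → v.mode = μ := by decide

theorem Role.eq_inn : ∀ (v : Role) (c : Bool), v.mode = .imp c → v.beats (.pos c) = true →
    v = .inn c := by decide

theorem Role.eq_str : ∀ (v : Role) (c : Bool), v.mode = .imp c → v.beats .goal = true →
    v = .str c := by decide

theorem Role.err_beats : ∀ (v : Role) (c : Bool), v.mode = .err c → v.beats .goal = true →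
    v.beats (.neg c) = false ∧ (v.beats (.row c) = false ∨ v.beats (.col c) = false) := by decide

theorem Role.sub_beats : ∀ v : Role, v.mode = .sub →
    v.beats (.pos false) = false ∨ v.beats (.neg true) = false := by decide

/-- In block 0 the only choice of kind inside a group is whether a fact belongs to a candidate; in
the other groups at most the fact is chosen. -/
theorem Kind.eq_of_group_eq {κ κ' : Kind} (h : κ.block = 0) (hg : κ.group = κ'.group) :
    κ = κ' ∨ ∃ c, (κ = .pos c ∧ κ' = .neg c) ∨ (κ = .neg c ∧ κ' = .pos c) := by
  revert κ κ'
  decide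

namespace IsGadget

variable {α : Type*} {F : Finset (Fact sigZero)} {prec₀ : Fact sigZero → Fact sigZero → Prop}
  {mk : Kind → Fact sigZero → α} {I : Finset α} {conf prec : α → α → Prop}

theorem role_unique (h : IsGadget F prec₀ mk I conf prec) {K : Finset α} (hK : Indep conf K)
    {v v' : Role} {f : Fact sigZero} (hv : mk (.role v) f ∈ K) (hv' : mk (.role v') f ∈ K) :
    v = v' := by
  by_contra hne
  refine hK _ hv _ hv' ((h.conf_iff _ _ _ _).2 (Or.inr ⟨⟨rfl, fun _ => rfl, fun _ => rfl⟩, ?_⟩))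
  rw [Ne, h.mk_eq_iff]
  simp [hne]

theorem mode_unique (h : IsGadget F prec₀ mk I conf prec) {K : Finset α} (hK : Indep conf K)
    {μ μ' : Mode} {f : Fact sigZero} (hv : mk (.mode μ) f ∈ K) (hv' : mk (.mode μ') f ∈ K) :
    μ = μ' := by
  by_contra hne
  refine hK _ hv _ hv' ((h.conf_iff _ _ _ _).2 (Or.inr ⟨⟨rfl, fun _ => rfl, fun _ => rfl⟩, ?_⟩))
  rw [Ne, h.mk_eq_iff]
  simp [hne]

theorem rowSel_unique (h : IsGadget F prec₀ mk I conf prec) {K : Finset α} (hK : Indep conf K)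
    {f f' : Fact sigZero} (hf : mk .rowSel f ∈ K) (hf' : mk .rowSel f' ∈ K)
    (ha : constA f = constA f') : f = f' := by
  by_contra hne
  refine hK _ hf _ hf' ((h.conf_iff _ _ _ _).2 (Or.inr ⟨⟨rfl, fun _ => ha, ?_⟩, ?_⟩))
  · simp [Kind.group]
  · rw [Ne, h.mk_eq_iff]
    simp [hne, Kind.usesFact]

theorem colSel_unique (h : IsGadget F prec₀ mk I conf prec) {K : Finset α} (hK : Indep conf K)
    {f f' : Fact sigZero} (hf : mk .colSel f ∈ K) (hf' : mk .colSel f' ∈ K)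
    (hb : constB f = constB f') : f = f' := by
  by_contra hne
  refine hK _ hf _ hf' ((h.conf_iff _ _ _ _).2 (Or.inr ⟨⟨rfl, ?_, fun _ => hb⟩, ?_⟩))
  · simp [Kind.group]
  · rw [Ne, h.mk_eq_iff]
    simp [hne, Kind.usesFact]

/-- The ways in which a node of a candidate can be dominated. -/
theorem dominated_cases (h : IsGadget F prec₀ mk I conf prec) {K : Finset α}
    {f₀ f : Fact sigZero} {κ : Kind} (hκ : κ.block = 0)
    (hd : ∃ y ∈ K, prec y (mk κ f)) :
    (∃ μ : Mode, μ.beats κ = true ∧ mk (.mode μ) f₀ ∈ K) ∨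
    (∃ (v : Role) (g : _), g ∈ F ∧ v.beats κ = true ∧ mk (.role v) g ∈ K ∧
      (κ.usesFact = true → g = f)) ∨
    (κ = .keyA ∧ mk .rowSel f ∈ K) ∨ (κ = .keyB ∧ mk .colSel f ∈ K) ∨
    ∃ c g, κ = .pos c ∧ prec₀ g f ∧ (mk (.role (.inn c)) g ∈ K ∨ mk (.role (.str c)) g ∈ K) := by
  obtain ⟨y, hy, hp⟩ := hd
  rcases (h.prec_iff _ _).1 hp with ⟨κ₁, κ₂, g, hg, hb, rfl, h₂⟩ | ⟨κ₁, κ₂, g, g', hl, hgg', rfl, h₂⟩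
  · obtain ⟨rfl, hfg⟩ := (h.mk_eq_iff _ _ _ _).1 h₂
    cases κ₁ with
    | top => simp [Kind.beats, hκ] at hb
    | mode μ =>
      refine Or.inl ⟨μ, hb, ?_⟩
      -- Mode nodes do not depend on a fact, so any `f₀` names them; a consistent refutation
      -- therefore has a single mode for all facts.
      rwa [(h.mk_eq_iff (.mode μ) f₀ (.mode μ) g).2 ⟨rfl, by simp [Kind.usesFact]⟩]
    | role v => exact Or.inr (Or.inl ⟨v, g, hg, hb, hy, fun hu => (hfg hu).symm⟩)
    | rowSel =>
      cases κ <;> simp [Kind.beats] at hb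
      refine Or.inr (Or.inr (Or.inl ⟨rfl, ?_⟩))
      rwa [hfg rfl]
    | colSel =>
      cases κ <;> simp [Kind.beats] at hb
      refine Or.inr (Or.inr (Or.inr (Or.inl ⟨rfl, ?_⟩)))
      rwa [hfg rfl]
    | _ => simp [Kind.beats] at hb
  · obtain ⟨rfl, hfg⟩ := (h.mk_eq_iff _ _ _ _).1 h₂
    obtain ⟨c, hc, rfl⟩ := Kind.lifts_iff.1 hl
    refine Or.inr (Or.inr (Or.inr (Or.inr ⟨c, g, rfl, ?_, ?_⟩)))
    · rwa [hfg rfl]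
    · rcases hc with rfl | rfl
      · exact Or.inl hy
      · exact Or.inr hy

/-- The nodes that represent a pair of candidates. -/
def Selected (J : Bool → Finset (Fact sigZero)) : Kind → Fact sigZero → Prop
  | .pos c, f => f ∈ J c
  | .neg c, f => f ∉ J c
  | .row c, f => f ∈ J c
  | .col c, f => f ∈ J c
  | .goal, _ => True
  | .keyA, _ => True
  | .keyB, _ => True
  | .gate _, _ => True
  | _, _ => False

theorem Selected.block {J : Bool → Finset (Fact sigZero)} {κ : Kind} {f : Fact sigZero}
    (h : Selected J κ f) : κ.block = 0 := by
  cases κ <;> first | rfl | exact h.elim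

/-- The row and column groups are where consistency of the candidates enters: each candidate has at
most one fact per value of A and per value of B. -/
theorem Selected.unique {J : Bool → Finset (Fact sigZero)}
    (hJ : ∀ c, Indep (Conflict schemaZero) (J c)) {κ κ' : Kind} {f f' : Fact sigZero}
    (h : Selected J κ f) (h' : Selected J κ' f') (hs : SameGroup κ f κ' f') :
    κ = κ' ∧ (κ.usesFact = true → f = f') := by
  obtain ⟨hg, ha, hb⟩ := hs
  have heq : ∀ c, f ∈ J c → f' ∈ J c → (constA f = constA f' ∨ constB f = constB f') →
      f = f' := fun c hf hf' heq => by
    by_contra hne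
    exact hJ c f hf f' hf' (conflict_schemaZero_iff.2 ⟨hne, heq⟩)
  rcases Kind.eq_of_group_eq h.block hg with rfl | ⟨c, ⟨rfl, rfl⟩ | ⟨rfl, rfl⟩⟩
  · refine ⟨rfl, fun hu => ?_⟩
    cases κ with
    | row c => exact heq c h h' (Or.inl (ha rfl))
    | col c => exact heq c h h' (Or.inr (hb rfl))
    | gate μ => cases μ <;> exact fact_sigZero_ext (ha rfl) (hb rfl)
    | pos c => exact fact_sigZero_ext (ha rfl) (hb rfl)
    | neg c => exact fact_sigZero_ext (ha rfl) (hb rfl)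
    | keyA => exact fact_sigZero_ext (ha rfl) (hb rfl)
    | keyB => exact fact_sigZero_ext (ha rfl) (hb rfl)
    | goal => simp [Kind.usesFact] at hu
    | _ => exact h.elim
  · rw [fact_sigZero_ext (ha rfl) (hb rfl)] at h
    exact absurd h h'
  · rw [fact_sigZero_ext (ha rfl) (hb rfl)] at h
    exact absurd h' h

/-- Two optimal repairs, the first of which is not contained in the second one, yield candidates
that are not refuted. -/
theorem exists_not_refuted (h : IsGadget F prec₀ mk I conf prec)
    {J : Bool → Finset (Fact sigZero)} (hJ : ∀ c, Optimal F (Conflict schemaZero) prec₀ (J c))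
    (hsub : ¬ J false ⊆ J true) :
    ∃ X ⊆ I, Indep conf X ∧ InBlock mk X 0 ∧ X.Nonempty ∧ ¬ Refuted mk I conf prec X := by
  classical
  obtain ⟨d, hd, hd'⟩ := Finset.not_subset.1 hsub
  have hdF := (hJ false).1 hd
  let X := I.filter fun x => ∃ κ, ∃ f ∈ F, Selected J κ f ∧ x = mk κ f
  have hX : ∀ x ∈ X, ∃ κ, ∃ f ∈ F, Selected J κ f ∧ x = mk κ f := fun x hx =>
    (Finset.mem_filter.1 hx).2
  have hmem : ∀ κ f, f ∈ F → Selected J κ f → mk κ f ∈ X := fun κ f hf hs =>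
    Finset.mem_filter.2 ⟨(h.mem_iff _).2 ⟨κ, f, hf, rfl⟩, κ, f, hf, hs, rfl⟩
  refine ⟨X, Finset.filter_subset _ _, ?_, ?_, ⟨_, hmem .goal d hdF trivial⟩, ?_⟩
  · intro x hx y hy hxy
    obtain ⟨κ, f, -, hs, rfl⟩ := hX x hx
    obtain ⟨κ', f', -, hs', rfl⟩ := hX y hy
    rcases (h.conf_iff _ _ _ _).1 hxy with hb | ⟨hg, hne⟩
    · exact hb (hs.block.trans hs'.block.symm)
    · exact hne ((h.mk_eq_iff _ _ _ _).2 (hs.unique (fun c => (hJ c).2.1) hs' hg))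
  · intro κ f hx
    obtain ⟨κ', f', -, hs, heq⟩ := hX _ hx
    rw [((h.mk_eq_iff _ _ _ _).1 heq).1]
    exact hs.block
  rintro ⟨K, hKI, hKi, hK1, hKX⟩
  have hdom : ∀ κ f, f ∈ F → Selected J κ f → _ := fun κ f hf hs =>
    h.dominated_cases (f₀ := d) hs.block (hKX _ (hmem κ f hf hs))
  -- The gates tie roles to the mode: a gate is spared by its own mode and then has to be dominated
  -- by a role of that mode on the same fact.
  have hgate : ∀ μ, ∀ f ∈ F, (∃ μ', μ' ≠ μ ∧ mk (.mode μ') d ∈ K) ∨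
      ∃ v : Role, v.mode = μ ∧ mk (.role v) f ∈ K := by
    intro μ f hf
    rcases hdom (.gate μ) f hf trivial with ⟨μ', hb, hm⟩ | ⟨v, g, -, hb, hm, hg⟩ | ⟨hk, -⟩ |
      ⟨hk, -⟩ | ⟨c, g, hk, -⟩
    · refine Or.inl ⟨μ', ?_, hm⟩
      rintro rfl
      simp [Mode.not_beats_gate] at hb
    · exact Or.inr ⟨v, v.mode_of_beats_gate μ hb, hg rfl ▸ hm⟩
    · cases hk
    · cases hk
    · cases hk
  -- Without any mode, two gates of `d` would force roles of two different modes on `d`, but a fact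
  -- carries only one role.
  obtain ⟨μ, hμ⟩ : ∃ μ, mk (.mode μ) d ∈ K := by
    by_contra! hcon
    obtain ⟨v, hv, hvK⟩ := (hgate .sub d hdF).resolve_left fun ⟨μ', _, hm⟩ => hcon μ' hm
    obtain ⟨v', hv', hvK'⟩ := (hgate (.imp true) d hdF).resolve_left fun ⟨μ', _, hm⟩ => hcon μ' hm
    rw [h.role_unique hKi hvK hvK', hv'] at hv
    cases hv
  have hmode : ∀ μ', mk (.mode μ') d ∈ K → μ' = μ := fun μ' hm => h.mode_unique hKi hm hμ
  have hrole : ∀ f ∈ F, ∃ v : Role, v.mode = μ ∧ mk (.role v) f ∈ K := fun f hf =>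
    (hgate μ f hf).resolve_left fun ⟨μ', hne, hm⟩ => hne (hmode μ' hm)
  have hrole' : ∀ (v : Role), ∀ f ∈ F, mk (.role v) f ∈ K → v.mode = μ := fun v f hf hv => by
    obtain ⟨v', hv', hm⟩ := hrole f hf
    rw [h.role_unique hKi hv hm, hv']
  cases μ with
  | imp c =>
    -- The supposed improvement, read off from the roles. These two roles spare the key nodes, which
    -- only the row and column selections can then dominate; a selection picks one fact per row or
    -- column, so `L` is consistent.
    let L := F.filter fun f => mk (.role (.inn c)) f ∈ K ∨ mk (.role (.str c)) f ∈ K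
    have hL : ∀ {f}, f ∈ L ↔ f ∈ F ∧ (mk (.role (.inn c)) f ∈ K ∨ mk (.role (.str c)) f ∈ K) :=
      Finset.mem_filter
    have hA : ∀ f ∈ L, mk .rowSel f ∈ K := by
      intro f hf
      obtain ⟨hf, hm⟩ := hL.1 hf
      rcases hdom .keyA f hf trivial with ⟨μ', hb, hm'⟩ | ⟨v, g, -, hb, hm', hg⟩ | ⟨-, hk⟩ |
        ⟨hk, -⟩ | ⟨c, g, hk, -⟩
      · rw [hmode _ hm'] at hb; simp [Mode.beats] at hb
      · obtain rfl := hg rfl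
        rcases hm with hm | hm <;> rw [h.role_unique hKi hm' hm] at hb <;>
          simp [Role.beats] at hb
      · exact hk
      · cases hk
      · cases hk
    have hB : ∀ f ∈ L, mk .colSel f ∈ K := by
      intro f hf
      obtain ⟨hf, hm⟩ := hL.1 hf
      rcases hdom .keyB f hf trivial with ⟨μ', hb, hm'⟩ | ⟨v, g, -, hb, hm', hg⟩ | ⟨hk, -⟩ |
        ⟨-, hk⟩ | ⟨c, g, hk, -⟩
      · rw [hmode _ hm'] at hb; simp [Mode.beats] at hb
      · obtain rfl := hg rfl
        rcases hm with hm | hm <;> rw [h.role_unique hKi hm' hm] at hb <;>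
          simp [Role.beats] at hb
      · cases hk
      · exact hk
      · cases hk
    have hLi : Indep (Conflict schemaZero) L := by
      intro f hf g hg hfg
      obtain ⟨hne, ha | hb⟩ := conflict_schemaZero_iff.1 hfg
      · exact hne (h.rowSel_unique hKi (hA f hf) (hA g hg) ha)
      · exact hne (h.colSel_unique hKi (hB f hf) (hB g hg) hb)
    have hpos : ∀ f ∈ J c, mk (.role (.inn c)) f ∈ K ∨ ∃ g ∈ L, prec₀ g f := by
      intro f hf
      have hfF := (hJ c).1 hf
      rcases hdom (.pos c) f hfF hf with ⟨μ', hb, hm'⟩ | ⟨v, g, -, hb, hm', hg⟩ | ⟨hk, -⟩ |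
        ⟨hk, -⟩ | ⟨c', g, hk, hp, hm⟩
      · rw [hmode _ hm'] at hb; simp [Mode.beats] at hb
      · obtain rfl := hg rfl
        exact Or.inl (v.eq_inn c (hrole' v g hfF hm') hb ▸ hm')
      · cases hk
      · cases hk
      · cases hk
        exact Or.inr ⟨g, hL.2 ⟨(h.prec_mem _ _ hp).1, hm⟩, hp⟩
    -- The goal can only be dominated by a fact with role `str`. That role does not beat its own
    -- `pos` node, and no fact of the consistent `L` has priority over it, so the fact is new.
    obtain ⟨g, hg, hgJ⟩ : ∃ g ∈ L, g ∉ J c := by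
      rcases hdom .goal d hdF trivial with ⟨μ', hb, hm'⟩ | ⟨v, g, hgF, hb, hm', -⟩ | ⟨hk, -⟩ |
        ⟨hk, -⟩ | ⟨c', g, hk, -⟩
      · rw [hmode _ hm'] at hb; simp [Mode.beats] at hb
      · have hv := hrole' v g hgF hm'
        obtain rfl := v.eq_str c hv hb
        have hgL : g ∈ L := hL.2 ⟨hgF, Or.inr hm'⟩
        refine ⟨g, hgL, fun hgJ => ?_⟩
        rcases hpos g hgJ with hm | ⟨g', hg', hp⟩
        · cases h.role_unique hKi hm hm'
        · exact hLi g' hg' g hgL (h.prec_conflict _ _ hp)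
      · cases hk
      · cases hk
      · cases hk
    refine (hJ c).2.2 L (Finset.filter_subset _ _) hLi ⟨fun heq => hgJ (heq ▸ hg), ?_⟩
    intro f hf hfL
    rcases hpos f hf with hm | ⟨g', hg', hp⟩
    · exact absurd (hL.2 ⟨(hJ c).1 hf, Or.inl hm⟩) hfL
    · exact ⟨g', hg', fun hg'' => (hJ c).2.1 g' hg'' f hf (h.prec_conflict _ _ hp), hp⟩
  | err c =>
    rcases hdom .goal d hdF trivial with ⟨μ', hb, hm'⟩ | ⟨v, g, hgF, hb, hm', -⟩ | ⟨hk, -⟩ |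
      ⟨hk, -⟩ | ⟨c', g, hk, -⟩
    · rw [hmode _ hm'] at hb; simp [Mode.beats] at hb
    · have hv := hrole' v g hgF hm'
      -- The claimed error sits at `g`. An error role spares `neg` and one of `row` and `col`, yet a
      -- correct encoding contains `neg` at `g`, or both `row` and `col`.
      have key : ∀ κ : Kind, κ = .neg c ∨ κ = .row c ∨ κ = .col c → Selected J κ g →
          v.beats κ = true := by
        intro κ hκ hs
        rcases hdom κ g hgF hs with ⟨μ', hb, hm⟩ | ⟨v', g', -, hb, hm, hg⟩ | ⟨hk, -⟩ |
          ⟨hk, -⟩ | ⟨c', g, hk, -⟩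
        · rw [hmode _ hm] at hb
          rcases hκ with rfl | rfl | rfl <;> simp [Mode.beats] at hb
        · obtain rfl := hg (by rcases hκ with rfl | rfl | rfl <;> rfl)
          rwa [h.role_unique hKi hm' hm]
        · rcases hκ with rfl | rfl | rfl <;> cases hk
        · rcases hκ with rfl | rfl | rfl <;> cases hk
        · rcases hκ with rfl | rfl | rfl <;> cases hk
      have hve := v.err_beats c hv hb
      by_cases hgJ : g ∈ J c
      · rw [key (.row c) (by simp) hgJ, key (.col c) (by simp) hgJ] at hve
        simp at hve
      · rw [key (.neg c) (by simp) hgJ] at hve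
        simp at hve
    · cases hk
    · cases hk
    · cases hk
  | sub =>
    obtain ⟨v, hv, hvK⟩ := hrole d hdF
    -- At the witness `d` of non-containment both `pos false` and `neg true` are present, and no
    -- role of this mode beats both.
    have key : ∀ κ : Kind, κ = .pos false ∨ κ = .neg true → Selected J κ d →
        v.beats κ = true := by
      intro κ hκ hs
      rcases hdom κ d hdF hs with ⟨μ', hb, hm⟩ | ⟨v', g', -, hb, hm, hg⟩ | ⟨hk, -⟩ |
        ⟨hk, -⟩ | ⟨c', g, hk, hp, hm⟩
      · rw [hmode _ hm] at hb
        rcases hκ with rfl | rfl <;> simp [Mode.beats] at hb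
      · obtain rfl := hg (by rcases hκ with rfl | rfl <;> rfl)
        rwa [h.role_unique hKi hvK hm]
      · rcases hκ with rfl | rfl <;> cases hk
      · rcases hκ with rfl | rfl <;> cases hk
      · rcases hm with hm | hm <;> cases hrole' _ g (h.prec_mem _ _ hp).1 hm
    have hvs := v.sub_beats hv
    rw [key (.pos false) (by simp) hd, key (.neg true) (by simp) hd'] at hvs
    simp at hvs

end IsGadget

end CleanDB

/-! ### From an unrefuted candidate set to two optimal repairs -/

namespace CleanDB

/-- This and the next seven lemmas list the block 0 nodes that a mode together with a role leaves
undominated at a fact: the only places where that refutation attempt can fail. -/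
theorem Kind.eq_of_skip : ∀ (c : Bool) (κ : Kind), κ.block = 0 → (Mode.err c).beats κ = false →
    (Role.skip c).beats κ = false → κ = .goal := by decide

theorem Kind.eq_of_errA : ∀ (c : Bool) (κ : Kind), κ.block = 0 → (Mode.err c).beats κ = false →
    (Role.errA c).beats κ = false → κ = .neg c ∨ κ = .row c := by decide

theorem Kind.eq_of_errB : ∀ (c : Bool) (κ : Kind), κ.block = 0 → (Mode.err c).beats κ = false →
    (Role.errB c).beats κ = false → κ = .neg c ∨ κ = .col c := by decide

theorem Kind.eq_of_inn : ∀ (c : Bool) (κ : Kind), κ.block = 0 → (Mode.imp c).beats κ = false →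
    (Role.inn c).beats κ = false → κ = .goal ∨ κ = .keyA ∨ κ = .keyB := by decide

theorem Kind.eq_of_str : ∀ (c : Bool) (κ : Kind), κ.block = 0 → (Mode.imp c).beats κ = false →
    (Role.str c).beats κ = false → κ = .pos c ∨ κ = .keyA ∨ κ = .keyB := by decide

theorem Kind.eq_of_out : ∀ (c : Bool) (κ : Kind), κ.block = 0 → (Mode.imp c).beats κ = false →
    (Role.out c).beats κ = false → κ = .pos c ∨ κ = .goal := by decide

theorem Kind.eq_of_both : ∀ κ : Kind, κ.block = 0 → Mode.sub.beats κ = false →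
    Role.both.beats κ = false → κ = .neg true := by decide

theorem Kind.eq_of_low : ∀ κ : Kind, κ.block = 0 → Mode.sub.beats κ = false →
    Role.low.beats κ = false → κ = .pos false := by decide

namespace IsGadget

variable {α : Type*} {F : Finset (Fact sigZero)} {prec₀ : Fact sigZero → Fact sigZero → Prop}
  {mk : Kind → Fact sigZero → α} {I : Finset α} {conf prec : α → α → Prop}

/-- If candidates are not refuted, then any attempt at a refutation fails at some node. -/
theorem exists_not_dominated (h : IsGadget F prec₀ mk I conf prec) {X : Finset α} (hXI : X ⊆ I)
    (hX0 : InBlock mk X 0) (hr : ¬ Refuted mk I conf prec X) (μ : Mode)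
    (w : Fact sigZero → Role) {E : Finset (Fact sigZero)}
    (hEi : Indep (Conflict schemaZero) E) :
    ∃ κ : Kind, ∃ f ∈ F, mk κ f ∈ X ∧ κ.block = 0 ∧ μ.beats κ = false ∧ (w f).beats κ = false ∧
      (κ = .goal → ∀ g ∈ F, (w g).beats .goal = false) ∧ (κ = .keyA → f ∉ E) ∧
      (κ = .keyB → f ∉ E) ∧
      ∀ c g, κ = .pos c → prec₀ g f → w g ≠ .inn c ∧ w g ≠ .str c := by
  classical
  by_contra! hcon
  -- The attempt consists of one mode, one role per fact, and the row and column selections on `E`;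
  -- these are consistent since `E` is.
  let N : Kind → Fact sigZero → Prop := fun κ f =>
    κ = .mode μ ∨ κ = .role (w f) ∨ (κ = .rowSel ∧ f ∈ E) ∨ (κ = .colSel ∧ f ∈ E)
  let K := I.filter fun x => ∃ κ, ∃ f ∈ F, N κ f ∧ x = mk κ f
  have hmem : ∀ κ f, f ∈ F → N κ f → mk κ f ∈ K := fun κ f hf hs =>
    Finset.mem_filter.2 ⟨(h.mem_iff _).2 ⟨κ, f, hf, rfl⟩, κ, f, hf, hs, rfl⟩
  have hN : ∀ κ f, N κ f → κ.block = 1 := by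
    rintro κ f (rfl | rfl | ⟨rfl, -⟩ | ⟨rfl, -⟩) <;> rfl
  refine hr ⟨K, Finset.filter_subset _ _, ?_, ?_, ?_⟩
  · intro x hx y hy hxy
    obtain ⟨-, κ, f, -, hs, rfl⟩ := Finset.mem_filter.1 hx
    obtain ⟨-, κ', f', -, hs', rfl⟩ := Finset.mem_filter.1 hy
    rcases (h.conf_iff _ _ _ _).1 hxy with hb | ⟨⟨hg, ha, hb⟩, hne⟩
    · exact hb ((hN _ _ hs).trans (hN _ _ hs').symm)
    · refine hne ((h.mk_eq_iff _ _ _ _).2 ?_)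
      have heq : f ∈ E → f' ∈ E → (constA f = constA f' ∨ constB f = constB f') → f = f' :=
        fun hf hf' heq => by
          by_contra hff
          exact hEi f hf f' hf' (conflict_schemaZero_iff.2 ⟨hff, heq⟩)
      rcases hs with rfl | rfl | ⟨rfl, hf⟩ | ⟨rfl, hf⟩ <;>
        rcases hs' with rfl | rfl | ⟨rfl, hf'⟩ | ⟨rfl, hf'⟩ <;>
        first | (simp [Kind.group] at hg; done) | skip
      · simp [Kind.usesFact]
      · have := fact_sigZero_ext (ha rfl) (hb rfl)
        subst this
        simp
      · exact ⟨rfl, fun _ => heq hf hf' (Or.inl (ha rfl))⟩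
      · exact ⟨rfl, fun _ => heq hf hf' (Or.inr (hb rfl))⟩
  · intro κ f hx
    obtain ⟨-, κ', f', -, hs, heq⟩ := Finset.mem_filter.1 hx
    rw [((h.mk_eq_iff _ _ _ _).1 heq).1]
    exact hN _ _ hs
  · intro x hx
    obtain ⟨κ, f, hf, rfl⟩ := (h.mem_iff x).1 (hXI hx)
    have hb : ∀ (κ' : Kind) (g : Fact sigZero), g ∈ F → N κ' g → κ'.beats κ = true →
        mk κ g = mk κ f → ∃ y ∈ K, prec y (mk κ f) := fun κ' g hg hs hb heq =>
      ⟨_, hmem κ' g hg hs, (h.prec_iff _ _).2 (Or.inl ⟨κ', κ, g, hg, hb, rfl, heq.symm⟩)⟩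
    by_cases h₁ : μ.beats κ = false
    swap
    · exact hb (.mode μ) f hf (Or.inl rfl) (Bool.eq_true_of_not_eq_false h₁) rfl
    by_cases h₂ : (w f).beats κ = false
    swap
    · exact hb (.role (w f)) f hf (Or.inr (Or.inl rfl)) (Bool.eq_true_of_not_eq_false h₂) rfl
    by_cases h₃ : κ = .goal → ∀ g ∈ F, (w g).beats .goal = false
    swap
    · push Not at h₃
      obtain ⟨rfl, g, hg, hw⟩ := h₃
      exact hb (.role (w g)) g hg (Or.inr (Or.inl rfl)) (by simpa [Kind.beats] using hw)
        ((h.mk_eq_iff _ _ _ _).2 ⟨rfl, by simp [Kind.usesFact]⟩)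
    by_cases h₄ : κ = .keyA → f ∉ E
    swap
    · push Not at h₄
      obtain ⟨rfl, hfE⟩ := h₄
      exact hb .rowSel f hf (Or.inr (Or.inr (Or.inl ⟨rfl, hfE⟩))) rfl rfl
    by_cases h₅ : κ = .keyB → f ∉ E
    swap
    · push Not at h₅
      obtain ⟨rfl, hfE⟩ := h₅
      exact hb .colSel f hf (Or.inr (Or.inr (Or.inr ⟨rfl, hfE⟩))) rfl rfl
    obtain ⟨c, g, rfl, hp, hw⟩ := hcon κ f hf hx (hX0 κ f hx) h₁ h₂ h₃ h₄ h₅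
    refine ⟨_, hmem (.role (w g)) g (h.prec_mem _ _ hp).1 (Or.inr (Or.inl rfl)),
      (h.prec_iff _ _).2 (Or.inr ⟨.role (w g), .pos c, g, f, ?_, hp, rfl, rfl⟩)⟩
    rw [Kind.lifts_iff]
    by_cases hi : w g = .inn c
    · exact ⟨c, Or.inl (by rw [hi]), rfl⟩
    · exact ⟨c, Or.inr (by rw [hw hi]), rfl⟩

/-- Candidates that are not refuted yield two optimal repairs, the first of which is not contained
in the second one. -/
theorem exists_optimal_not_subset (h : IsGadget F prec₀ mk I conf prec)
    {X : Finset α} (hXI : X ⊆ I) (hXi : Indep conf X) (hX0 : InBlock mk X 0)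
    (hr : ¬ Refuted mk I conf prec X) :
    ∃ J : Bool → Finset (Fact sigZero), (∀ c, Optimal F (Conflict schemaZero) prec₀ (J c)) ∧
      ¬ J false ⊆ J true := by
  classical
  let J : Bool → Finset (Fact sigZero) := fun c => F.filter fun f => mk (.pos c) f ∈ X
  have hJ : ∀ {c f}, f ∈ J c ↔ f ∈ F ∧ mk (.pos c) f ∈ X := Finset.mem_filter
  have hneg : ∀ c f, mk (.neg c) f ∈ X → f ∉ J c := by
    intro c f hn hf
    refine hXi _ hn _ (hJ.1 hf).2 ((h.conf_iff _ _ _ _).2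
      (Or.inr ⟨⟨rfl, fun _ => rfl, fun _ => rfl⟩, ?_⟩))
    rw [Ne, h.mk_eq_iff]
    simp
  have hempty : Indep (Conflict schemaZero) ∅ := by simp [Indep]
  have hrow : ∀ c, ∀ f ∈ J c, mk (.row c) f ∈ X := by
    intro c f hf
    -- Attempt to refute by claiming a missing row entry at `f` alone. The goal is dominated by the
    -- error role at `f`, so the attempt can fail only at `neg` or `row` of `f`, and `neg` is
    -- excluded by `pos`.
    obtain ⟨κ, g, hg, hκ, h0, h₁, h₂, h₃, -⟩ := h.exists_not_dominated hXI hX0 hr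
      (.err c) (fun g => if g = f then .errA c else .skip c) hempty
    by_cases hgf : g = f
    · subst hgf
      rw [if_pos rfl] at h₂
      rcases Kind.eq_of_errA c κ h0 h₁ h₂ with rfl | rfl
      · exact absurd hf (hneg c g hκ)
      · exact hκ
    · rw [if_neg hgf] at h₂
      have := h₃ (Kind.eq_of_skip c κ h0 h₁ h₂) f (hJ.1 hf).1
      simp [Role.beats] at this
  have hcol : ∀ c, ∀ f ∈ J c, mk (.col c) f ∈ X := by
    intro c f hf
    obtain ⟨κ, g, hg, hκ, h0, h₁, h₂, h₃, -⟩ := h.exists_not_dominated hXI hX0 hr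
      (.err c) (fun g => if g = f then .errB c else .skip c) hempty
    by_cases hgf : g = f
    · subst hgf
      rw [if_pos rfl] at h₂
      rcases Kind.eq_of_errB c κ h0 h₁ h₂ with rfl | rfl
      · exact absurd hf (hneg c g hκ)
      · exact hκ
    · rw [if_neg hgf] at h₂
      have := h₃ (Kind.eq_of_skip c κ h0 h₁ h₂) f (hJ.1 hf).1
      simp [Role.beats] at this
  have hJi : ∀ c, Indep (Conflict schemaZero) (J c) := by
    intro c f hf g hg hfg
    obtain ⟨hne, hk⟩ := conflict_schemaZero_iff.1 hfg
    rcases hk with ha | hb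
    · refine hXi _ (hrow c f hf) _ (hrow c g hg) ((h.conf_iff _ _ _ _).2
        (Or.inr ⟨⟨rfl, fun _ => ha, by simp [Kind.group]⟩, ?_⟩))
      rw [Ne, h.mk_eq_iff]
      simp [hne, Kind.usesFact]
    · refine hXi _ (hcol c f hf) _ (hcol c g hg) ((h.conf_iff _ _ _ _).2
        (Or.inr ⟨⟨rfl, by simp [Kind.group], fun _ => hb⟩, ?_⟩))
      rw [Ne, h.mk_eq_iff]
      simp [hne, Kind.usesFact]
  refine ⟨J, fun c => ⟨Finset.filter_subset _ _, hJi c, ?_⟩, fun hsub => ?_⟩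
  · rintro L hL hLi ⟨hne, himp⟩
    -- An improvement contained in `J c` could dominate nothing outside itself, and would equal `J
    -- c`.
    obtain ⟨d, hdL, hdJ⟩ : ∃ d ∈ L, d ∉ J c := by
      by_contra! hcon
      refine hne (subset_antisymm hcon fun f hf => ?_)
      by_contra hfL
      obtain ⟨g, hg, hgJ, -⟩ := himp f hf hfL
      exact hgJ (hcon g hg)
    -- Play `L` itself as a refutation in mode `imp c`. The new fact `d` dominates the goal,
    -- selections on `L` handle the keys, and dropped facts are dominated by the lifted priorities,
    -- so the attempt has nowhere to fail.
    obtain ⟨κ, f, hf, hκ, h0, h₁, h₂, h₃, h₄, h₅, h₆⟩ := h.exists_not_dominated hXI hX0 hr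
      (.imp c) (fun g => if g ∈ L then if g ∈ J c then .inn c else .str c else .out c) hLi
    have hgoal : κ ≠ .goal := by
      rintro rfl
      have := h₃ rfl d (hL hdL)
      simp [hdL, hdJ, Role.beats] at this
    by_cases hfL : f ∈ L
    · have hA : κ ≠ .keyA := fun hk => h₄ hk hfL
      have hB : κ ≠ .keyB := fun hk => h₅ hk hfL
      rw [if_pos hfL] at h₂
      by_cases hfJ : f ∈ J c
      · rw [if_pos hfJ] at h₂
        rcases Kind.eq_of_inn c κ h0 h₁ h₂ with hk | hk | hk
        · exact hgoal hk
        · exact hA hk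
        · exact hB hk
      · rw [if_neg hfJ] at h₂
        rcases Kind.eq_of_str c κ h0 h₁ h₂ with rfl | hk | hk
        · exact hfJ (hJ.2 ⟨hf, hκ⟩)
        · exact hA hk
        · exact hB hk
    · rw [if_neg hfL] at h₂
      obtain rfl := (Kind.eq_of_out c κ h0 h₁ h₂).resolve_right hgoal
      obtain ⟨g, hg, hgJ, hp⟩ := himp f (hJ.2 ⟨hf, hκ⟩) hfL
      have := (h₆ c g rfl hp).2
      simp [hg, hgJ] at this
  · obtain ⟨κ, f, hf, hκ, h0, h₁, h₂, -⟩ := h.exists_not_dominated hXI hX0 hr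
      .sub (fun g => if g ∈ J false then .both else .low) hempty
    by_cases hfJ : f ∈ J false
    · rw [if_pos hfJ] at h₂
      obtain rfl := Kind.eq_of_both κ h0 h₁ h₂
      exact hneg true f hκ (hsub hfJ)
    · rw [if_neg hfJ] at h₂
      obtain rfl := Kind.eq_of_low κ h0 h₁ h₂
      exact hfJ (hJ.2 ⟨hf, hκ⟩)

/-- The gadget has a unique optimal repair if and only if the facts have one. -/
theorem existsUnique_optimal_iff (h : IsGadget F prec₀ mk I conf prec) :
    (∃! J, Optimal I conf prec J) ↔ ∃! J, Optimal F (Conflict schemaZero) prec₀ J := by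
  classical
  have hirr : ∀ f, ¬ Conflict schemaZero f f := fun f hf => (conflict_schemaZero_iff.1 hf).1 rfl
  -- Without facts the gadget has no top node, so this case is separate.
  rcases F.eq_empty_or_nonempty with rfl | hF
  · have hI : I = ∅ := Finset.eq_empty_of_forall_notMem fun x hx => by
      obtain ⟨κ, f, hf, -⟩ := (h.mem_iff x).1 hx
      simp at hf
    rw [hI]
    exact iff_of_true existsUnique_optimal_empty existsUnique_optimal_empty
  rw [h.existsUnique_iff hF]
  constructor
  · intro hall
    obtain ⟨J, hJ⟩ := exists_optimal hirr h.acyclic F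
    refine ⟨J, hJ, fun J' hJ' => ?_⟩
    by_contra hne
    obtain ⟨X, hXI, hXi, hX0, hXne, hr⟩ := h.exists_not_refuted
      (J := fun c => if c then J else J') (fun c => by cases c <;> simpa)
      (by simpa using hJ'.not_subset hJ hne)
    exact hr (hall X hXI hXi hX0 hXne)
  · intro hu X hXI hXi hX0 _
    by_contra hr
    obtain ⟨J, hJ, hsub⟩ := h.exists_optimal_not_subset hXI hXi hX0 hr
    exact hsub (hu.unique (hJ false) (hJ true)).le

end IsGadget

end CleanDB

namespace CleanDB

/-! ### The reductions -/

section Reduction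

variable {S : Schema} {R : Fin S.sig.num}

/-- The facts that arise from the facts of `D` by means of templates. -/
def templateFacts (T₁ : List (Template (S.sig.arity R))) (D : Input schemaZero) :
    List (Fact S.sig) :=
  D.facts.flatMap fun φ => T₁.map fun τ => τ.fact φ

/-- The priorities that arise from the facts and the priorities of `D` by means of templates. -/
def templatePairs (T₂ T₃ : List (Template (S.sig.arity R) × Template (S.sig.arity R)))
    (D : Input schemaZero) : List (Fact S.sig × Fact S.sig) :=
  (D.facts.flatMap fun φ => T₂.map fun t => (t.1.fact φ, t.2.fact φ)) ++
    D.pairs.flatMap fun p => T₃.map fun t => (t.1.fact p.1, t.2.fact p.2)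

/-- Hardness is transferred by a reduction given by templates. -/
theorem GCategoricityCoNPHard.of_template (T₁ : List (Template (S.sig.arity R)))
    (T₂ T₃ : List (Template (S.sig.arity R) × Template (S.sig.arity R)))
    (hmem : ∀ D f g, (f, g) ∈ templatePairs T₂ T₃ D →
      f ∈ templateFacts T₁ D ∧ g ∈ templateFacts T₁ D)
    (hac : ∀ D f, ¬ Relation.TransGen (fun f g => (f, g) ∈ templatePairs T₂ T₃ D) f f)
    (hconf : ∀ D f g, (f, g) ∈ templatePairs T₂ T₃ D → Conflict S f g)
    (hiff : ∀ D : Input schemaZero,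
      (∃! J, Optimal (templateFacts T₁ D).toFinset (Conflict S)
        (fun f g => (f, g) ∈ templatePairs T₂ T₃ D) J) ↔
      ∃! J, Optimal D.facts.toFinset (Conflict schemaZero) (fun f g => (f, g) ∈ D.pairs) J)
    (h : GCategoricityCoNPHard schemaZero) : GCategoricityCoNPHard S := by
  intro L hL
  obtain ⟨f, hf, hfL⟩ := h L hL
  have hvalid : ∀ D : Input schemaZero, IsPrioritizing (templateFacts T₁ D).toFinset
      (conflictGraph S (templateFacts T₁ D).toFinset)
      (fun f g => (f, g) ∈ templatePairs T₂ T₃ D) := fun D =>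
    { edge_subset := conflictGraph_subset
      mem := fun f g hp => by simpa using hmem D f g hp
      acyclic := hac D
      neighbors := fun f g hp =>
        neighbors_of_conflict (by simpa using (hmem D f g hp).1) (by simpa using (hmem D f g hp).2)
          (hconf D f g hp) }
  refine ⟨fun x => ⟨templateFacts T₁ (f x), templatePairs T₂ T₃ (f x), hvalid (f x)⟩,
    hf.template T₁ T₂ T₃ _ (fun _ => rfl) (fun _ => rfl), fun x => ?_⟩
  rw [hfL, mem_gCategoricity_iff, mem_gCategoricity_iff]
  exact (hiff (f x)).symm

/-! #### Two violating sets with non-violating intersection -/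

/-- The template whose facts agree on `P` if the first constants agree, and on `Q` if the second
constants agree. -/
def gridTemplate {k : ℕ} (P Q : Finset (Fin k)) : Template k :=
  fun j => (0, decide (j ∉ Q), decide (j ∉ P))

theorem mem_agreement_gridTemplate {P Q : Finset (Fin (S.sig.arity R))} {f g : Fact sigZero}
    {j : Fin (S.sig.arity R)} :
    j ∈ agreement ((gridTemplate P Q).tuple f) ((gridTemplate P Q).tuple g) ↔
      (j ∉ Q → constA f = constA g) ∧ (j ∉ P → constB f = constB g) := by
  simp [agreement, Template.tuple, attrValue_inj, gridTemplate]

theorem Violating.exists_notMem {Z : Finset (Fin (S.sig.arity R))} (h : Violating S R Z) :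
    ∃ j, j ∉ Z := by
  by_contra! hcon
  exact not_violating_univ S R (Finset.eq_univ_of_forall hcon ▸ h)

theorem gridTemplate_fact_injective {P Q : Finset (Fin (S.sig.arity R))} (hP : Violating S R P)
    (hQ : Violating S R Q) :
    Function.Injective ((gridTemplate P Q).fact : Fact sigZero → Fact S.sig) := by
  intro f g hfg
  have h : ∀ j, attrValue (gridTemplate P Q j) (constA f) (constB f) =
      attrValue (gridTemplate P Q j) (constA g) (constB g) := congrFun (Template.fact_inj.1 hfg)
  obtain ⟨i, hi⟩ := hP.exists_notMem
  obtain ⟨j, hj⟩ := hQ.exists_notMem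
  exact fact_sigZero_ext ((attrValue_inj.1 (h j)).2.1 (by simpa [gridTemplate] using hj))
    ((attrValue_inj.1 (h i)).2.2 (by simpa [gridTemplate] using hi))

/-- Distinct facts agree on `P`, `Q` or `P ∩ Q` according to whether they share the first constant,
the second, or none. -/
theorem conflict_gridTemplate_iff {P Q : Finset (Fin (S.sig.arity R))} (hP : Violating S R P)
    (hQ : Violating S R Q) (hPQ : ¬ Violating S R (P ∩ Q)) {f g : Fact sigZero} :
    Conflict S ((gridTemplate P Q).fact (R := R) f) ((gridTemplate P Q).fact (R := R) g) ↔
      Conflict schemaZero f g := by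
  have h : Conflict S ((gridTemplate P Q).fact (R := R) f) ((gridTemplate P Q).fact (R := R) g) ↔
      Violating S R
        (agreement ((gridTemplate P Q).tuple f) ((gridTemplate P Q).tuple g)) := conflict_iff
  rw [h, conflict_schemaZero_iff]
  by_cases ha : constA f = constA g <;> by_cases hb : constB f = constB g
  · obtain rfl := fact_sigZero_ext ha hb
    rw [agreement_self]
    simpa using not_violating_univ S R
  · have hag : agreement ((gridTemplate P Q).tuple f) ((gridTemplate P Q).tuple g) = P := by
      ext j; simp [mem_agreement_gridTemplate, ha, hb]
    rw [hag]
    refine iff_of_true hP ⟨?_, Or.inl ha⟩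
    rintro rfl; exact hb rfl
  · have hag : agreement ((gridTemplate P Q).tuple f) ((gridTemplate P Q).tuple g) = Q := by
      ext j; simp [mem_agreement_gridTemplate, ha, hb]
    rw [hag]
    refine iff_of_true hQ ⟨?_, Or.inr hb⟩
    rintro rfl; exact ha rfl
  · have hag : agreement ((gridTemplate P Q).tuple f) ((gridTemplate P Q).tuple g) = P ∩ Q := by
      ext j; simp [mem_agreement_gridTemplate, ha, hb, and_comm]
    rw [hag]
    exact iff_of_false hPQ (by simp [ha, hb])

theorem gCategoricityCoNPHard_of_grid {P Q : Finset (Fin (S.sig.arity R))} (hP : Violating S R P)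
    (hQ : Violating S R Q) (hPQ : ¬ Violating S R (P ∩ Q))
    (h : GCategoricityCoNPHard schemaZero) : GCategoricityCoNPHard S := by
  have hinj := gridTemplate_fact_injective hP hQ
  have hfacts : ∀ (D : Input schemaZero) (x : Fact S.sig),
      x ∈ templateFacts (S := S) [gridTemplate P Q] D ↔
        ∃ f ∈ D.facts, (gridTemplate P Q).fact f = x := fun D x => by
    simp [templateFacts, eq_comm]
  have hpairs : ∀ (D : Input schemaZero) (x y : Fact S.sig),
      (x, y) ∈ templatePairs (S := S) [] [(gridTemplate P Q, gridTemplate P Q)] D ↔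
        ∃ f g, (f, g) ∈ D.pairs ∧ (gridTemplate P Q).fact f = x ∧
          (gridTemplate P Q).fact g = y := fun D x y => by
    simp [templatePairs, eq_comm]
  refine GCategoricityCoNPHard.of_template [gridTemplate P Q] []
    [(gridTemplate P Q, gridTemplate P Q)] ?_ ?_ ?_ ?_ h
  · intro D x y hxy
    obtain ⟨f, g, hfg, rfl, rfl⟩ := (hpairs D x y).1 hxy
    have := D.valid.mem f g hfg
    simp only [List.mem_toFinset] at this
    exact ⟨(hfacts D _).2 ⟨f, this.1, rfl⟩, (hfacts D _).2 ⟨g, this.2, rfl⟩⟩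
  · intro D x hx
    have key : ∀ y, Relation.TransGen (fun f g => (f, g) ∈
        templatePairs (S := S) [] [(gridTemplate P Q, gridTemplate P Q)] D) x y →
        ∃ f g, (gridTemplate P Q).fact f = x ∧ (gridTemplate P Q).fact g = y ∧
          Relation.TransGen (fun f g => (f, g) ∈ D.pairs) f g := by
      intro y hy
      induction hy with
      | single hp =>
        obtain ⟨f, g, hfg, rfl, rfl⟩ := (hpairs D _ _).1 hp
        exact ⟨f, g, rfl, rfl, .single hfg⟩
      | tail _ hp ih =>
        obtain ⟨f, g, rfl, rfl, ht⟩ := ih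
        obtain ⟨g', g'', hfg, heq, rfl⟩ := (hpairs D _ _).1 hp
        rw [hinj heq] at hfg
        exact ⟨f, g'', rfl, rfl, ht.tail hfg⟩
    obtain ⟨f, g, rfl, heq, ht⟩ := key x hx
    rw [hinj heq] at ht
    exact D.valid.acyclic f ht
  · intro D x y hxy
    obtain ⟨f, g, hfg, rfl, rfl⟩ := (hpairs D x y).1 hxy
    exact (conflict_gridTemplate_iff hP hQ hPQ).2 (D.conflict hfg)
  · intro D
    have himage : (templateFacts (S := S) [gridTemplate P Q] D).toFinset =
        D.facts.toFinset.image ((gridTemplate P Q).fact : Fact sigZero → Fact S.sig) := by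
      ext x
      simp only [List.mem_toFinset, Finset.mem_image, hfacts]
    rw [himage]
    refine existsUnique_optimal_image_iff hinj
      (fun f _ g _ => conflict_gridTemplate_iff hP hQ hPQ) fun f _ g _ => ?_
    rw [hpairs]
    constructor
    · rintro ⟨f', g', hp, hf, hg⟩
      rwa [hinj hf, hinj hg] at hp
    · intro hp
      exact ⟨f, g, hp, rfl, rfl⟩

/-! #### A chain of two dependencies -/

theorem Kind.usesFact_of_group (κ : Kind) :
    (κ.group.2.1 = true → κ.usesFact = true) ∧ (κ.group.2.2 = true → κ.usesFact = true) := by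
  revert κ
  decide

/-- The template for the nodes of a kind. -/
noncomputable def nodeTemplate {k : ℕ} (X₀ Y₀ X₁ : Finset (Fin k)) (κ : Kind) : Template k :=
  fun j =>
    if j ∈ X₀ then (0, false, false)
    else if j ∈ Y₀ then (κ.block, false, false)
    else if j ∈ X₁ then κ.group
    else (Fintype.equivFin Kind κ, κ.usesFact, κ.usesFact)

/-- The node of a kind for a fact. -/
noncomputable def node (R : Fin S.sig.num) (X₀ Y₀ X₁ : Finset (Fin (S.sig.arity R))) (κ : Kind)
    (f : Fact sigZero) : Fact S.sig :=
  (nodeTemplate X₀ Y₀ X₁ κ).fact (R := R) f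

variable {X₀ Y₀ X₁ : Finset (Fin (S.sig.arity R))}

theorem mem_agreement_node {κ κ' : Kind} {f f' : Fact sigZero} {j : Fin (S.sig.arity R)} :
    j ∈ agreement ((nodeTemplate X₀ Y₀ X₁ κ).tuple f) ((nodeTemplate X₀ Y₀ X₁ κ').tuple f') ↔
      if j ∈ X₀ then True else if j ∈ Y₀ then κ.block = κ'.block
      else if j ∈ X₁ then SameGroup κ f κ' f'
      else κ = κ' ∧ (κ.usesFact = true → f = f') := by
  have h : j ∈ agreement ((nodeTemplate X₀ Y₀ X₁ κ).tuple f) ((nodeTemplate X₀ Y₀ X₁ κ').tuple f') ↔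
      attrValue (nodeTemplate X₀ Y₀ X₁ κ j) (constA f) (constB f) =
        attrValue (nodeTemplate X₀ Y₀ X₁ κ' j) (constA f') (constB f') := by
    simp only [agreement, Finset.mem_filter, Finset.mem_univ, true_and]
    rfl
  rw [h, attrValue_inj]
  unfold nodeTemplate
  split_ifs
  · simp
  · simp
  · rfl
  · constructor
    · rintro ⟨hid, ha, hb⟩
      simp only [Prod.mk.injEq, Fin.val_inj, EmbeddingLike.apply_eq_iff_eq] at hid
      exact ⟨hid.1, fun hu => fact_sigZero_ext (ha hu) (hb hu)⟩
    · rintro ⟨rfl, hf⟩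
      exact ⟨rfl, fun hu => by rw [hf hu], fun hu => by rw [hf hu]⟩

theorem node_eq_iff (hX₁ : Violating S R X₁) (h₀ : X₀ ⊆ Y₀) (h₁ : Y₀ ⊆ X₁) {κ κ' : Kind}
    {f f' : Fact sigZero} :
    node R X₀ Y₀ X₁ κ f = node R X₀ Y₀ X₁ κ' f' ↔ κ = κ' ∧ (κ.usesFact = true → f = f') := by
  constructor
  · intro h
    obtain ⟨j, hj⟩ := hX₁.exists_notMem
    have hm : j ∈ agreement ((nodeTemplate X₀ Y₀ X₁ κ).tuple f)
        ((nodeTemplate X₀ Y₀ X₁ κ').tuple f') := by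
      simp only [agreement, Finset.mem_filter, Finset.mem_univ, true_and]
      exact congrFun (Template.fact_inj.1 h) j
    rwa [mem_agreement_node, if_neg fun h => hj (h₁ (h₀ h)), if_neg fun h => hj (h₁ h),
      if_neg hj] at hm
  · rintro ⟨rfl, hf⟩
    have hag : ∀ j, j ∈ agreement ((nodeTemplate X₀ Y₀ X₁ κ).tuple f)
        ((nodeTemplate X₀ Y₀ X₁ κ).tuple f') := by
      intro j
      rw [mem_agreement_node]
      split_ifs
      · trivial
      · exact ⟨rfl, fun hu => by rw [hf (κ.usesFact_of_group.1 hu)],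
          fun hu => by rw [hf (κ.usesFact_of_group.2 hu)]⟩
      · exact ⟨rfl, hf⟩
    refine Template.fact_inj.2 (funext fun j => ?_)
    simpa [agreement] using hag j

/-- Nodes in different blocks agree on all of `X₀` but not on all of `Y₀`, which is violating by
`hchain`. Inside a block, distinct nodes agree exactly on `X₁` in the same group and exactly on `Y₀`
otherwise. -/
theorem conflict_node_iff (h₀ : X₀ ⊆ Y₀) (h₁ : Y₀ ⊆ X₁) (hX₀ : Violating S R X₀)
    (hchain : ∀ Z, X₀ ⊆ Z → ¬ Y₀ ⊆ Z → Violating S R Z) (hY₀ : ¬ Violating S R Y₀)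
    (hX₁ : Violating S R X₁) {κ κ' : Kind} {f f' : Fact sigZero} :
    Conflict S (node R X₀ Y₀ X₁ κ f) (node R X₀ Y₀ X₁ κ' f') ↔
      κ.block ≠ κ'.block ∨
        (SameGroup κ f κ' f' ∧ node R X₀ Y₀ X₁ κ f ≠ node R X₀ Y₀ X₁ κ' f') := by
  have h : Conflict S (node R X₀ Y₀ X₁ κ f) (node R X₀ Y₀ X₁ κ' f') ↔
      Violating S R (agreement ((nodeTemplate X₀ Y₀ X₁ κ).tuple f)
        ((nodeTemplate X₀ Y₀ X₁ κ').tuple f')) := conflict_iff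
  rw [h, Ne, Ne, node_eq_iff hX₁ h₀ h₁]
  by_cases hb : κ.block = κ'.block
  swap
  · refine iff_of_true (hchain _ (fun j hj => ?_) fun hsub => ?_) (Or.inl hb)
    · rw [mem_agreement_node, if_pos hj]; trivial
    -- The inclusion of `X₀` in `Y₀` is proper, as only one of them is violating, so some attribute
    -- records the block.
    · obtain ⟨j, hj, hj'⟩ : ∃ j ∈ Y₀, j ∉ X₀ := by
        by_contra! hcon
        exact hY₀ (subset_antisymm h₀ hcon ▸ hX₀)
      have := hsub hj
      rw [mem_agreement_node, if_neg hj', if_pos hj] at this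
      exact hb this
  simp only [hb, not_true_eq_false, false_or]
  have key : ∀ j, j ∈ agreement ((nodeTemplate X₀ Y₀ X₁ κ).tuple f)
      ((nodeTemplate X₀ Y₀ X₁ κ').tuple f') ↔
      j ∈ Y₀ ∨ (j ∈ X₁ ∧ SameGroup κ f κ' f') ∨ (κ = κ' ∧ (κ.usesFact = true → f = f')) := by
    intro j
    have hsg : κ = κ' ∧ (κ.usesFact = true → f = f') → SameGroup κ f κ' f' := by
      rintro ⟨rfl, hf⟩
      exact ⟨rfl, fun hu => by rw [hf (κ.usesFact_of_group.1 hu)],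
        fun hu => by rw [hf (κ.usesFact_of_group.2 hu)]⟩
    have := @h₀ j
    have := @h₁ j
    rw [mem_agreement_node]
    split_ifs <;> tauto
  by_cases heq : κ = κ' ∧ (κ.usesFact = true → f = f')
  · have hag : agreement ((nodeTemplate X₀ Y₀ X₁ κ).tuple f)
        ((nodeTemplate X₀ Y₀ X₁ κ').tuple f') = Finset.univ := by
      ext j; exact iff_of_true ((key j).2 (Or.inr (Or.inr heq))) (Finset.mem_univ j)
    rw [hag]
    exact iff_of_false (not_violating_univ S R) fun hc => hc.2 heq
  by_cases hsg : SameGroup κ f κ' f'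
  · have hag : agreement ((nodeTemplate X₀ Y₀ X₁ κ).tuple f)
        ((nodeTemplate X₀ Y₀ X₁ κ').tuple f') = X₁ := by
      ext j
      rw [key]
      have := @h₁ j
      tauto
    rw [hag]
    exact iff_of_true hX₁ ⟨hsg, heq⟩
  · have hag : agreement ((nodeTemplate X₀ Y₀ X₁ κ).tuple f)
        ((nodeTemplate X₀ Y₀ X₁ κ').tuple f') = Y₀ := by
      ext j
      rw [key]
      tauto
    rw [hag]
    exact iff_of_false hY₀ fun hc => hsg hc.1

theorem gCategoricityCoNPHard_of_chain (h₀ : X₀ ⊆ Y₀) (h₁ : Y₀ ⊆ X₁) (hX₀ : Violating S R X₀)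
    (hchain : ∀ Z, X₀ ⊆ Z → ¬ Y₀ ⊆ Z → Violating S R Z) (hY₀ : ¬ Violating S R Y₀)
    (hX₁ : Violating S R X₁) (h : GCategoricityCoNPHard schemaZero) :
    GCategoricityCoNPHard S := by
  let τ : Kind → Template (S.sig.arity R) := nodeTemplate X₀ Y₀ X₁
  let T₁ := (Finset.univ : Finset Kind).toList.map τ
  let T₂ := ((Finset.univ : Finset (Kind × Kind)).filter fun p => p.1.beats p.2 = true).toList.map
    fun p => (τ p.1, τ p.2)
  let T₃ := ((Finset.univ : Finset (Kind × Kind)).filter fun p => p.1.lifts p.2 = true).toList.map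
    fun p => (τ p.1, τ p.2)
  have hg : ∀ D : Input schemaZero, IsGadget D.facts.toFinset (fun f g => (f, g) ∈ D.pairs)
      (node R X₀ Y₀ X₁) (templateFacts T₁ D).toFinset (Conflict S)
      (fun f g => (f, g) ∈ templatePairs T₂ T₃ D) := fun D =>
    { prec_conflict := fun f g hp => D.conflict hp
      prec_mem := D.valid.mem
      acyclic := D.valid.acyclic
      mk_eq_iff := fun κ f κ' f' => node_eq_iff hX₁ h₀ h₁
      mem_iff := fun x => by
        simp only [List.mem_toFinset, templateFacts, T₁, List.mem_flatMap, List.mem_map,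
          Finset.mem_toList, Finset.mem_univ, true_and, exists_exists_eq_and]
        constructor
        · rintro ⟨f, hf, κ, rfl⟩; exact ⟨κ, f, hf, rfl⟩
        · rintro ⟨κ, f, hf, rfl⟩; exact ⟨f, hf, κ, rfl⟩
      conf_iff := fun κ f κ' f' => conflict_node_iff h₀ h₁ hX₀ hchain hY₀ hX₁
      prec_iff := fun x y => by
        simp only [templatePairs, T₂, T₃, List.mem_append, List.mem_flatMap, List.mem_map,
          Finset.mem_toList, Finset.mem_filter, Finset.mem_univ, true_and, Prod.exists,
          Prod.mk.injEq, List.mem_toFinset]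
        constructor
        · rintro (⟨f, hf, _, _, ⟨κ, κ', hb, rfl, rfl⟩, rfl, rfl⟩ |
            ⟨f, g, hp, _, _, ⟨κ, κ', hb, rfl, rfl⟩, rfl, rfl⟩)
          · exact Or.inl ⟨κ, κ', f, hf, hb, rfl, rfl⟩
          · exact Or.inr ⟨κ, κ', f, g, hb, hp, rfl, rfl⟩
        · rintro (⟨κ, κ', f, hf, hb, rfl, rfl⟩ | ⟨κ, κ', f, g, hb, hp, rfl, rfl⟩)
          · exact Or.inl ⟨f, hf, _, _, ⟨κ, κ', hb, rfl, rfl⟩, rfl, rfl⟩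
          · exact Or.inr ⟨f, g, hp, _, _, ⟨κ, κ', hb, rfl, rfl⟩, rfl, rfl⟩ }
  have hnode : ∀ D f g, (f, g) ∈ templatePairs T₂ T₃ D → ∃ κ κ' φ ψ, φ ∈ D.facts.toFinset ∧
      ψ ∈ D.facts.toFinset ∧ f = node R X₀ Y₀ X₁ κ φ ∧ g = node R X₀ Y₀ X₁ κ' ψ := by
    intro D f g hp
    rcases ((hg D).prec_iff f g).1 hp with ⟨κ, κ', φ, hφ, -, rfl, rfl⟩ |
      ⟨κ, κ', φ, ψ, -, hp', rfl, rfl⟩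
    · exact ⟨κ, κ', φ, φ, hφ, hφ, rfl, rfl⟩
    · exact ⟨κ, κ', φ, ψ, (D.valid.mem φ ψ hp').1, (D.valid.mem φ ψ hp').2, rfl, rfl⟩
  refine GCategoricityCoNPHard.of_template T₁ T₂ T₃ ?_ (fun D => (hg D).acyclic_prec) ?_
    (fun D => (hg D).existsUnique_optimal_iff) h
  · intro D f g hp
    obtain ⟨κ, κ', φ, ψ, hφ, hψ, rfl, rfl⟩ := hnode D f g hp
    rw [← List.mem_toFinset, ← List.mem_toFinset]
    exact ⟨((hg D).mem_iff _).2 ⟨κ, φ, hφ, rfl⟩, ((hg D).mem_iff _).2 ⟨κ', ψ, hψ, rfl⟩⟩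
  · intro D f g hp
    obtain ⟨κ, κ', φ, ψ, hφ, hψ, rfl, rfl⟩ := hnode D f g hp
    have := (hg D).block_of_prec hp
    exact ((hg D).conf_iff _ _ _ _).2 (Or.inl (by omega))

end Reduction

end CleanDB

theorem mainTheorem10 :
    CleanDB.GCategoricityCoNPHard CleanDB.schemaZero ↔
      ∀ S : CleanDB.Schema, ¬ S.SingleFDPerRelation → CleanDB.GCategoricityCoNPHard S := by
  refine ⟨fun h S hS => ?_, fun h => h _ CleanDB.not_singleFDPerRelation_schemaZero⟩
  simp only [CleanDB.Schema.SingleFDPerRelation, not_forall, not_exists, not_and] at hS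
  obtain ⟨R, hR⟩ := hS
  rcases CleanDB.exists_of_not_single hR with
    ⟨P, Q, hP, hQ, hPQ⟩ | ⟨X₀, Y₀, X₁, h₀, h₁, hX₀, hchain, hY₀, hX₁⟩
  · exact CleanDB.gCategoricityCoNPHard_of_grid hP hQ hPQ h
  · exact CleanDB.gCategoricityCoNPHard_of_chain h₀ h₁ hX₀ hchain hY₀ hX₁ h
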